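/- **Setting.** The cells of the square grid are the points of $\mathbb Z^2$. A neighborhood is a finite set $F\subset\mathbb Z^2$; the neighborhood of a cell $d$ is the translate $d+F$. In the odd-rule cellular automaton of $F$, a cell is ON at generation $n+1$ if and only if it lies in the neighborhoods of an odd number of the cells that are ON at generation $n$. The automaton starts at generation $0$ with a single ON cell at the origin; $a_n(F)$ is the number of ON cells at generation $n$, and $b_n(F)=a_{2^n-1}(F)$. A height-one neighborhood is a subset (possibly empty) of the $3\times3$ grid $\{-1,0,1\}^2$. Its Odd-rule number is obtained by reading the nine cells from left to right and from top to bottom as binary digits (ON $=1$, most significant digit first); it is written as three octal digits, one for each row. Two height-one neighborhoods $F,G$ are combinatorially equivalent if $a_n(F)=a_n(G)$ for all $n\ge 0$. They are trivially equivalent if one can be carried to the other by repeated translations, rotations and reflections of the square grid. **Theorem.** (1) Up to combinatorial equivalence there are exactly $48$ height-one neighborhoods. The 48 Odd-rule numbers in the list below form a system of representatives, and each of them is the smallest Odd-rule number in its class. For each of them the generating function $\sum_{n\ge0}b_n(F)x^n$, as a formal power series, is the rational function listed next to it, whose denominator has constant term $1$. These 48 rational functions are pairwise distinct. (2) Up to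 trivial equivalence there are exactly $86$ height-one neighborhoods. A system of representatives, each of them the smallest Odd-rule number in its class, consists of the 48 numbers of the list together with the 38 numbers given in brackets. A number in brackets is combinatorially equivalent to the number on whose line it stands, so that its sequence $b_n$ has the generating function on that line. **List.** - 000: $1$ - 001: $1/(1-x)$ - 003 [005, 012, 014, 104]: $1/(1-2x)$ - 007 [124]: $(1+2x)/((1+x)(1-2x))$ - 013 [015, 016, 025, 105, 106, 141, 142]: $1/(1-3x)$ - 017 [027, 107, 125, 126, 151]: $(1+2x)/(1-2x-4x^{2})$ - 033 [036, 055, 154, 162, 252, 505]: $1/(1-4x)$ - 035 [116, 145]: $(1-x)/((1-2x)(1-3x))$ - 037 [136, 155]: $(1+x)/(1-4x+x^{2})$ - 057 [174, 272, 507, 525]: $(1+2x)/(1-3x-2x^{2})$ - 077 [555]: $(1+4x)/((1+2x)(1-4x))$ - 117 [127]: $(1+3x)(1-x)/((1-3x)(1-3x^{2}))$ - 137: $(1+3x)/((1+x)(1-4x))$ - 143: $(1-x)(1-x+x^{2}-x^{3}-4x^{4}+2x^{5}-2x^{6})/(1-6x+10x^{2}-4x^{3}-3x^{4}+12x^{5}-20x^{6}+10x^{7}-4x^{8})$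 - 146 [152]: $(1-x+2x^{2}+2x^{3})/((1-3x-2x^{2})(1-2x+2x^{2}))$ - 147: $(1-x)(1+2x+7x^{4}+4x^{5}+2x^{6})/(1-4x-x^{2}+8x^{3}+7x^{4}-26x^{5}+11x^{6}+14x^{7}+2x^{8}-4x^{9})$ - 153: $(1-x-5x^{2}+9x^{3}-12x^{4}+14x^{5}-4x^{6}+8x^{7})/(1-6x+6x^{2}+20x^{3}-51x^{4}+56x^{5}-46x^{6}+20x^{7}-8x^{8})$ - 156 [253]: $(1-x+2x^{2}-4x^{3})/((1-x)(1-5x+6x^{2}-4x^{3}))$ - 157: $(1+x-9x^{2}+15x^{3}+2x^{4}-34x^{5}+20x^{6}-16x^{7}-8x^{8})/(1-5x+x^{2}+25x^{3}-44x^{4}+2x^{5}+56x^{6}-40x^{7}+24x^{8}+16x^{9})$ - 161: $(1-x)(1+x+2x^{2})/(1-4x+x^{2}+2x^{3}+4x^{4})$ - 163: $(1-x)(1+x-x^{2}+x^{3})/(1-5x+24x^{3}-15x^{4}-17x^{5})$ - 165: $(1-x)(1+x)(1+x-x^{2})/((1-x-x^{2})(1-3x-5x^{2}+11x^{3}))$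 - 166 [172]: $(1+x)/(1-4x-x^{2}+4x^{3}+8x^{4})$ - 167: $(1+2x)(1-x)/((1-4x)(1-2x)(1+x))$ - 171: $(1+2x)(1+2x+3x^{2}+4x^{3})/(1-x-5x^{2}-13x^{3}-6x^{4}-8x^{5})$ - 173: $(1+2x)(1+x-2x^{2}-x^{3}-5x^{4}-7x^{5}+2x^{6}-7x^{7}+6x^{8})/(1-3x-6x^{2}+9x^{3}+9x^{4}+7x^{5}-2x^{6}-15x^{7}+4x^{8}+8x^{9}+8x^{10})$ - 175: $(1+2x)(1+x-x^{2}+x^{3}+2x^{5})/(1-3x-3x^{2}+x^{3}+6x^{4}-10x^{5}+8x^{6}-8x^{7})$ - 176 [273]: $(1+3x)/((1-x)(1+2x)(1-4x))$ - 177: $(1+4x-3x^{3}+6x^{4}-6x^{5}-12x^{6}-12x^{7})/((1+x)(1-4x-2x^{2}+9x^{3}+2x^{4}+2x^{5}-8x^{6}+12x^{7}))$ - 255: $(1-x+6x^{2})/((1-x)(1-2x)(1-3x))$ - 257: $(1-8x^{2}-16x^{3})/((1-4x)(1-2x-4x^{2}))$ - 275: $(1+3x+4x^{2})/((1-x)(1+2x)(1-4x))$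 - 277: $(1+2x-7x^{2}+12x^{3}-16x^{5}-16x^{6})/(1-5x+3x^{2}+9x^{3}-16x^{4}+16x^{6}+16x^{7})$ - 345: $(1-x)(1-x^{2}-2x^{3}-6x^{4})/(1-6x+10x^{2}-8x^{3}+15x^{4}-10x^{5}-10x^{6})$ - 347: $(1-3x^{2}+4x^{3})/((1-2x)(1-4x+x^{2}))$ - 356: $(1+2x)/(1-4x)$ - 357: $(1+x-16x^{2}+28x^{3}-8x^{4})/(1-6x+5x^{2}+24x^{3}-44x^{4}+8x^{5})$ - 365: $(1-x)/((1-3x)(1-4x))$ - 367: $(1+2x-4x^{2}-7x^{3}+5x^{4}-2x^{5}+9x^{7}-2x^{8}+6x^{9})/(1-5x+21x^{3}-18x^{4}-3x^{5}+24x^{6}-31x^{7}+11x^{8}-22x^{9}-10x^{10})$ - 376 [557]: $(1+4x)/((1+x)(1-4x))$ - 377: $(1-20x^{2}+56x^{3}-49x^{4}-36x^{5}+128x^{6}-128x^{7})/(1-8x+16x^{2}+24x^{3}-145x^{4}+236x^{5}-164x^{6}+24x^{7}+32x^{8})$ - 517: $(1-x)(1+2x-3x^{2}-6x^{3}-2x^{4}+4x^{5})/((1+x)(1-2x)(1-4x+x^{2}+2x^{4}-4x^{5}))$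 - 527: $(1+2x)(1-x)/((1-2x)(1-3x-2x^{2}))$ - 537: $(1+4x)(1-x)/((1-4x)(1-7x^{2}))$ - 575: $(1+2x)(1+2x+4x^{2})/(1-3x-8x^{3}-8x^{4})$ - 577: $(1+4x+6x^{3}+x^{4}+8x^{5}-4x^{6})/(1-4x-6x^{3}+29x^{4}-12x^{5}-8x^{6}+8x^{7})$ - 757: $(1+6x)/((1+2x)(1-4x))$ - 777: $(1+6x-8x^{2})/((1-x)(1+2x)(1-4x))$ -/

import Mathlib

namespace OddRule

section

open Polynomial

/-- A cell of the square grid; the pair `(i, j)` is the cell centered at that lattice point. -/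
abbrev Cell : Type := ℤ × ℤ

/-! ### The automaton -/

/-- One generation of the odd-rule automaton with neighborhood `F` (a finite set of cells around
the origin; the neighborhood of the cell `d` is the translate `d + F`): a cell `c` is ON in the new
generation iff it lies in the neighborhood `d + F` of an odd number of cells `d` that were ON.
Only cells of `S + F` lie in any such neighborhood, see `mem_step`. -/
def step (F S : Finset Cell) : Finset Cell :=
  (Finset.image₂ (fun d f => d + f) S F).filter
    (fun c => Odd (S.filter (fun d => c - d ∈ F)).card)

theorem mem_step (F S : Finset Cell) (c : Cell) :
    c ∈ step F S ↔ Odd (S.filter (fun d => c - d ∈ F)).card := by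
  unfold step
  rw [Finset.mem_filter, and_iff_right_iff_imp]
  intro h
  obtain ⟨d, hd⟩ := Finset.card_pos.mp h.pos
  rw [Finset.mem_filter] at hd
  exact Finset.mem_image₂.mpr ⟨d, hd.1, c - d, hd.2, add_sub_cancel d c⟩

/-- The set of ON cells at generation `n`, starting with a single ON cell at the origin. -/
def state (F : Finset Cell) : ℕ → Finset Cell
  | 0 => {(0, 0)}
  | n + 1 => step F (state F n)

/-- `a_n(F)`: the number of ON cells at generation `n`. -/
def a (F : Finset Cell) (n : ℕ) : ℕ := (state F n).card

/-- `b_n(F) = a_{2^n - 1}(F)`. -/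
def b (F : Finset Cell) (n : ℕ) : ℕ := a F (2 ^ n - 1)

/-! ### Height-one neighborhoods and their Odd-rule numbers -/

/-- The height: the maximum of `|i|` and `|j|` over the cells `(i, j)` of `F` (`0` if `F = ∅`). -/
def height (F : Finset Cell) : ℕ := F.sup (fun c => max c.1.natAbs c.2.natAbs)

/-- The height-one neighborhoods, that is, the subsets of the `3 × 3` grid around the origin. -/
abbrev HeightOne : Type := {F : Finset Cell // height F ≤ 1}

/-- Position of the binary digit of the cell `(i, j)` of the `3 × 3` grid, when the cells are read
from left to right and from top to bottom, most significant digit first: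
the cell `(-1, 1)` has position `8` and the cell `(1, -1)` has position `0`. -/
def digit (c : Cell) : ℕ := (3 * (c.2 + 1) + (1 - c.1)).toNat

/-- The Odd-rule number of a height-one neighborhood. -/
def ruleNumber (F : Finset Cell) : ℕ := ∑ c ∈ F, 2 ^ digit c

/-- The height-one neighborhood with Odd-rule number `N < 512`. -/
def nbhd (N : ℕ) : Finset Cell :=
  (({-1, 0, 1} : Finset ℤ) ×ˢ ({-1, 0, 1} : Finset ℤ)).filter (fun c => N.testBit (digit c))

/-- The number with octal digits `p q r`. -/
def octal (p q r : ℕ) : ℕ := 64 * p + 8 * q + r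

/-! ### The two equivalence relations -/

/-- Combinatorial equivalence: the same number of ON cells at every generation. -/
def CombEquiv (F G : Finset Cell) : Prop := ∀ n : ℕ, a F n = a G n

/-- Combinatorial equivalence of height-one neighborhoods, as a setoid. -/
def combSetoid : Setoid HeightOne where
  r F G := CombEquiv F.1 G.1
  iseqv := ⟨fun _ _ => rfl, fun h n => (h n).symm, fun h k n => (h n).trans (k n)⟩

/-- An elementary move: a translation, the rotation by a quarter turn, or a reflection. (The
rotation and this reflection generate the eight symmetries of the square.) -/
inductive Move : Finset Cell → Finset Cell → Prop
  | translate (v : Cell) (F : Finset Cell) : Move F (F.image (fun c => c + v))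
  | rotate (F : Finset Cell) : Move F (F.image (fun c => (-c.2, c.1)))
  | reflect (F : Finset Cell) : Move F (F.image (fun c => (-c.1, c.2)))

/-- Trivial (or affine) equivalence: `F` can be carried to `G` by repeated translations, rotations
and reflections. -/
def TrivEquiv (F G : Finset Cell) : Prop := Relation.EqvGen Move F G

/-- Trivial equivalence of height-one neighborhoods, as a setoid. -/
def trivSetoid : Setoid HeightOne := (Relation.EqvGen.setoid Move).comap Subtype.val

/-! ### The tables -/

/-- The sequence `u` has the rational generating function `num / den`:
`∑ u_n X^n = num / den` as formal power series, where `den` has constant term `1`. -/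
def HasGenFun (u : ℕ → ℕ) (num den : ℤ[X]) : Prop :=
  den.coeff 0 = 1 ∧
    (den : PowerSeries ℤ) * PowerSeries.mk (fun n => (u n : ℤ)) = (num : PowerSeries ℤ)

/-- The polynomial with the listed coefficients: `[c₀, c₁, c₂, …]` is `c₀ + c₁ X + c₂ X² + ⋯`. -/
noncomputable def ofCoeffs : List ℤ → ℤ[X]
  | [] => 0
  | c :: l => C c + X * ofCoeffs l

/-- A product of polynomials, each of them given by its list of coefficients. -/
noncomputable def ofFactors (l : List (List ℤ)) : ℤ[X] := (l.map ofCoeffs).prod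

/-- An Odd-rule number together with a rational function, whose numerator and denominator are given
by their factors. For example `⟨octal 3 6 5, [[1, -1]], [[1, -3], [1, -4]]⟩` stands for rule 365
with the rational function `(1 - X) / ((1 - 3 X) (1 - 4 X))`. -/
structure Entry where
  rule : ℕ
  numFactors : List (List ℤ)
  denFactors : List (List ℤ)

/-- The numerator of the rational function. -/
noncomputable def Entry.num (e : Entry) : ℤ[X] := ofFactors e.numFactors

/-- The denominator of the rational function. -/
noncomputable def Entry.den (e : Entry) : ℤ[X] := ofFactors e.denFactors

/-- The 48 Odd-rule numbers that represent the combinatorial equivalence classes, with the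
generating functions of the sequences `b_n`. -/
def genFunTable : List Entry :=
  [
   ⟨octal 0 0 0, [[1]],
      [[1]]⟩,
   ⟨octal 0 0 1, [[1]],
      [[1, -1]]⟩,
   ⟨octal 0 0 3, [[1]],
      [[1, -2]]⟩,
   ⟨octal 0 0 7, [[1, 2]],
      [[1, 1], [1, -2]]⟩,
   ⟨octal 0 1 3, [[1]],
      [[1, -3]]⟩,
   ⟨octal 0 1 7, [[1, 2]],
      [[1, -2, -4]]⟩,
   ⟨octal 0 3 3, [[1]],
      [[1, -4]]⟩,
   ⟨octal 0 3 5, [[1, -1]],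
      [[1, -2], [1, -3]]⟩,
   ⟨octal 1 4 3, [[1, -1], [1, -1, 1, -1, -4, 2, -2]],
      [[1, -6, 10, -4, -3, 12, -20, 10, -4]]⟩,
   ⟨octal 1 4 6, [[1, -1, 2, 2]],
      [[1, -3, -2], [1, -2, 2]]⟩,
   ⟨octal 1 6 1, [[1, -1], [1, 1, 2]],
      [[1, -4, 1, 2, 4]]⟩,
   ⟨octal 0 3 7, [[1, 1]],
      [[1, -4, 1]]⟩,
   ⟨octal 0 5 7, [[1, 2]],
      [[1, -3, -2]]⟩,
   ⟨octal 1 1 7, [[1, 3], [1, -1]],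
      [[1, -3], [1, 0, -3]]⟩,
   ⟨octal 1 4 7, [[1, -1], [1, 2, 0, 0, 7, 4, 2]],
      [[1, -4, -1, 8, 7, -26, 11, 14, 2, -4]]⟩,
   ⟨octal 1 5 3, [[1, -1, -5, 9, -12, 14, -4, 8]],
      [[1, -6, 6, 20, -51, 56, -46, 20, -8]]⟩,
   ⟨octal 1 5 6, [[1, -1, 2, -4]],
      [[1, -1], [1, -5, 6, -4]]⟩,
   ⟨octal 1 6 3, [[1, -1], [1, 1, -1, 1]],
      [[1, -5, 0, 24, -15, -17]]⟩,
   ⟨octal 1 6 5, [[1, -1], [1, 1], [1, 1, -1]],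
      [[1, -1, -1], [1, -3, -5, 11]]⟩,
   ⟨octal 1 6 6, [[1, 1]],
      [[1, -4, -1, 4, 8]]⟩,
   ⟨octal 1 7 1, [[1, 2], [1, 2, 3, 4]],
      [[1, -1, -5, -13, -6, -8]]⟩,
   ⟨octal 2 5 5, [[1, -1, 6]],
      [[1, -1], [1, -2], [1, -3]]⟩,
   ⟨octal 3 4 5, [[1, -1], [1, 0, -1, -2, -6]],
      [[1, -6, 10, -8, 15, -10, -10]]⟩,
   ⟨octal 0 7 7, [[1, 4]],
      [[1, 2], [1, -4]]⟩,
   ⟨octal 1 3 7, [[1, 3]],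
      [[1, 1], [1, -4]]⟩,
   ⟨octal 1 5 7, [[1, 1, -9, 15, 2, -34, 20, -16, -8]],
      [[1, -5, 1, 25, -44, 2, 56, -40, 24, 16]]⟩,
   ⟨octal 1 6 7, [[1, 2], [1, -1]],
      [[1, -4], [1, -2], [1, 1]]⟩,
   ⟨octal 1 7 3, [[1, 2], [1, 1, -2, -1, -5, -7, 2, -7, 6]],
      [[1, -3, -6, 9, 9, 7, -2, -15, 4, 8, 8]]⟩,
   ⟨octal 1 7 5, [[1, 2], [1, 1, -1, 1, 0, 2]],
      [[1, -3, -3, 1, 6, -10, 8, -8]]⟩,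
   ⟨octal 1 7 6, [[1, 3]],
      [[1, -1], [1, 2], [1, -4]]⟩,
   ⟨octal 2 5 7, [[1, 0, -8, -16]],
      [[1, -4], [1, -2, -4]]⟩,
   ⟨octal 2 7 5, [[1, 3, 4]],
      [[1, -1], [1, 2], [1, -4]]⟩,
   ⟨octal 3 4 7, [[1, 0, -3, 4]],
      [[1, -2], [1, -4, 1]]⟩,
   ⟨octal 3 5 6, [[1, 2]],
      [[1, -4]]⟩,
   ⟨octal 3 6 5, [[1, -1]],
      [[1, -3], [1, -4]]⟩,
   ⟨octal 5 1 7, [[1, -1], [1, 2, -3, -6, -2, 4]],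
      [[1, 1], [1, -2], [1, -4, 1, 0, 2, -4]]⟩,
   ⟨octal 5 2 7, [[1, 2], [1, -1]],
      [[1, -2], [1, -3, -2]]⟩,
   ⟨octal 1 7 7, [[1, 4, 0, -3, 6, -6, -12, -12]],
      [[1, 1], [1, -4, -2, 9, 2, 2, -8, 12]]⟩,
   ⟨octal 2 7 7, [[1, 2, -7, 12, 0, -16, -16]],
      [[1, -5, 3, 9, -16, 0, 16, 16]]⟩,
   ⟨octal 3 5 7, [[1, 1, -16, 28, -8]],
      [[1, -6, 5, 24, -44, 8]]⟩,
   ⟨octal 3 6 7, [[1, 2, -4, -7, 5, -2, 0, 9, -2, 6]],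
      [[1, -5, 0, 21, -18, -3, 24, -31, 11, -22, -10]]⟩,
   ⟨octal 3 7 6, [[1, 4]],
      [[1, 1], [1, -4]]⟩,
   ⟨octal 5 3 7, [[1, 4], [1, -1]],
      [[1, -4], [1, 0, -7]]⟩,
   ⟨octal 5 7 5, [[1, 2], [1, 2, 4]],
      [[1, -3, 0, -8, -8]]⟩,
   ⟨octal 3 7 7, [[1, 0, -20, 56, -49, -36, 128, -128]],
      [[1, -8, 16, 24, -145, 236, -164, 24, 32]]⟩,
   ⟨octal 5 7 7, [[1, 4, 0, 6, 1, 8, -4]],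
      [[1, -4, 0, -6, 29, -12, -8, 8]]⟩,
   ⟨octal 7 5 7, [[1, 6]],
      [[1, 2], [1, -4]]⟩,
   ⟨octal 7 7 7, [[1, 6, -8]],
      [[1, -1], [1, 2], [1, -4]]⟩]

/-- The 86 canonical Odd-rule numbers that represent the trivial equivalence classes, each followed
by the Odd-rule number that represents its combinatorial equivalence class. -/
def ruleTable : List (ℕ × ℕ) :=
  [
   (octal 0 0 0, octal 0 0 0), (octal 0 0 1, octal 0 0 1), (octal 0 0 3, octal 0 0 3),
   (octal 0 0 5, octal 0 0 3), (octal 0 1 2, octal 0 0 3), (octal 0 1 4, octal 0 0 3),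
   (octal 1 0 4, octal 0 0 3), (octal 0 0 7, octal 0 0 7), (octal 0 1 3, octal 0 1 3),
   (octal 0 1 5, octal 0 1 3), (octal 0 1 6, octal 0 1 3), (octal 0 2 5, octal 0 1 3),
   (octal 1 0 5, octal 0 1 3), (octal 1 0 6, octal 0 1 3), (octal 1 2 4, octal 0 0 7),
   (octal 1 4 1, octal 0 1 3), (octal 1 4 2, octal 0 1 3), (octal 0 1 7, octal 0 1 7),
   (octal 0 2 7, octal 0 1 7), (octal 0 3 3, octal 0 3 3), (octal 0 3 5, octal 0 3 5),
   (octal 0 3 6, octal 0 3 3), (octal 0 5 5, octal 0 3 3), (octal 1 0 7, octal 0 1 7),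
   (octal 1 1 6, octal 0 3 5), (octal 1 2 5, octal 0 1 7), (octal 1 2 6, octal 0 1 7),
   (octal 1 4 3, octal 1 4 3), (octal 1 4 5, octal 0 3 5), (octal 1 4 6, octal 1 4 6),
   (octal 1 5 1, octal 0 1 7), (octal 1 5 2, octal 1 4 6), (octal 1 5 4, octal 0 3 3),
   (octal 1 6 1, octal 1 6 1), (octal 1 6 2, octal 0 3 3), (octal 2 5 2, octal 0 3 3),
   (octal 5 0 5, octal 0 3 3), (octal 0 3 7, octal 0 3 7), (octal 0 5 7, octal 0 5 7),
   (octal 1 1 7, octal 1 1 7), (octal 1 2 7, octal 1 1 7), (octal 1 3 6, octal 0 3 7),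
   (octal 1 4 7, octal 1 4 7), (octal 1 5 3, octal 1 5 3), (octal 1 5 5, octal 0 3 7),
   (octal 1 5 6, octal 1 5 6), (octal 1 6 3, octal 1 6 3), (octal 1 6 5, octal 1 6 5),
   (octal 1 6 6, octal 1 6 6), (octal 1 7 1, octal 1 7 1), (octal 1 7 2, octal 1 6 6),
   (octal 1 7 4, octal 0 5 7), (octal 2 5 3, octal 1 5 6), (octal 2 5 5, octal 2 5 5),
   (octal 2 7 2, octal 0 5 7), (octal 3 4 5, octal 3 4 5), (octal 5 0 7, octal 0 5 7),
   (octal 5 2 5, octal 0 5 7), (octal 0 7 7, octal 0 7 7), (octal 1 3 7, octal 1 3 7),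
   (octal 1 5 7, octal 1 5 7), (octal 1 6 7, octal 1 6 7), (octal 1 7 3, octal 1 7 3),
   (octal 1 7 5, octal 1 7 5), (octal 1 7 6, octal 1 7 6), (octal 2 5 7, octal 2 5 7),
   (octal 2 7 3, octal 1 7 6), (octal 2 7 5, octal 2 7 5), (octal 3 4 7, octal 3 4 7),
   (octal 3 5 6, octal 3 5 6), (octal 3 6 5, octal 3 6 5), (octal 5 1 7, octal 5 1 7),
   (octal 5 2 7, octal 5 2 7), (octal 5 5 5, octal 0 7 7), (octal 1 7 7, octal 1 7 7),
   (octal 2 7 7, octal 2 7 7), (octal 3 5 7, octal 3 5 7), (octal 3 6 7, octal 3 6 7),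
   (octal 3 7 6, octal 3 7 6), (octal 5 3 7, octal 5 3 7), (octal 5 5 7, octal 3 7 6),
   (octal 5 7 5, octal 5 7 5), (octal 3 7 7, octal 3 7 7), (octal 5 7 7, octal 5 7 7),
   (octal 7 5 7, octal 7 5 7), (octal 7 7 7, octal 7 7 7)]

end

end OddRule

/-!
A state of the automaton is the set of exponents of a Laurent polynomial in two variables over
`𝔽₂`, and the `n`-th state is the set of exponents of the `n`-th power of the polynomial `P` of the
neighborhood (`poly_state`). So `a_n` is the number of terms, the *weight*, of `P ^ n`.

*Decimation.* Over `𝔽₂`, squaring doubles the exponents, so that the weight of `Q * R ^ 2` is the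
sum of the weights of `Q_p * R`, where `Q_p` collects the terms of `Q` with exponents congruent
to `p` modulo `2` (`weight_mul_sq`). When `P` is supported in a `3 × 3` square and `Q` in a `2 × 2`
block, the four parts of `Q * P` again live in a `2 × 2` block. Hence the sixteen subsets of the
block are the states of a finite system of recursions for the weights of `Q * P ^ n`
(`blockWeight_even`, `blockWeight_odd`).

*Generating functions.* At the generations `2 ^ n - 1` only the odd step occurs, so `b_n` is an
entry of the orbit of a `16 × 16` matrix. By Cayley–Hamilton it satisfies a linear recurrence of
order `16`, and a proposed rational generating function is correct as soon as it is correct up to a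
certain finite order (`hasGenFun_of_check`). That order is reached by a computation with the
recursion. The first five terms of `b_n` already separate the 48 sequences.

*Combinatorial equivalences.* An injective affine map of `ℤ²`, surjective or not, does not change
the sequence `a_n` (`combEquiv_image`). Together with three equivalences that follow from
linear relations between the weights of the sixteen states of the two rules (162 and 033, 272 and
057, 557 and 376), this covers all equivalences claimed.

*Trivial equivalence.* The smallest Odd-rule number among the translates of the eight images of a
height-one neighborhood under the symmetries of the square is a complete invariant. The intermediate
neighborhoods of a chain of moves need not be of height one; therefore the invariant is attached to
an arbitrary neighborhood as a set of numbers (`canonicalSet`) that no move changes.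
-/

namespace OddRule

open Finset

open AddMonoidAlgebra (single)

/-! ### The automaton as powers of a Laurent polynomial over `𝔽₂` -/

/-- Laurent polynomials in two variables over the field with two elements; a polynomial is the
same thing as the finite set of its exponents. -/
abbrev Laurent : Type := AddMonoidAlgebra (ZMod 2) Cell

/-- The Laurent polynomial whose set of exponents is `F`. -/
noncomputable def poly (F : Finset Cell) : Laurent := ∑ c ∈ F, single c 1

/-- The number of terms of a Laurent polynomial over `𝔽₂`. -/
def weight (Q : Laurent) : ℕ := Q.coeff.support.card

theorem coeff_poly (F : Finset Cell) (c : Cell) : (poly F).coeff c = if c ∈ F then 1 else 0 := by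
  simp [poly, AddMonoidAlgebra.coeff_sum, Finsupp.finsetSum_apply, Finsupp.single_apply]

theorem support_poly (F : Finset Cell) : (poly F).coeff.support = F := by
  ext c
  simp [coeff_poly]

theorem weight_poly (F : Finset Cell) : weight (poly F) = F.card := by
  rw [weight, support_poly]

theorem coeff_mul_poly (S F : Finset Cell) (c : Cell) :
    (poly S * poly F).coeff c = ((S.filter (fun d => c - d ∈ F)).card : ZMod 2) := by
  rw [poly, Finset.sum_mul, AddMonoidAlgebra.coeff_sum, Finsupp.finsetSum_apply]
  simp [coeff_poly, Finset.sum_boole, sub_eq_neg_add]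

theorem poly_step (F S : Finset Cell) : poly (step F S) = poly S * poly F := by
  ext c
  rw [coeff_poly, coeff_mul_poly, if_congr (mem_step F S c) rfl rfl]
  split_ifs with h
  · exact (ZMod.natCast_eq_one_iff_odd.mpr h).symm
  · exact (ZMod.natCast_eq_zero_iff_even.mpr (Nat.not_odd_iff_even.mp h)).symm

theorem poly_state (F : Finset Cell) (n : ℕ) : poly (state F n) = poly F ^ n := by
  induction n with
  | zero => simp [state, poly, AddMonoidAlgebra.one_def, Prod.mk_zero_zero]
  | succ n ih => rw [state, poly_step, ih, pow_succ]

theorem a_eq_weight (F : Finset Cell) (n : ℕ) : a F n = weight (poly F ^ n) := by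
  rw [a, ← poly_state, weight_poly]

/-! ### Affine changes of coordinates -/

theorem weight_single_mul (v : Cell) (Q : Laurent) : weight (single v 1 * Q) = weight Q := by
  rw [weight, AddMonoidAlgebra.support_coeff_single_mul _ _ (by simp), Finset.card_map, weight]

theorem weight_mapDomain (φ : Cell →+ Cell) (hφ : Function.Injective φ) (Q : Laurent) :
    weight (AddMonoidAlgebra.mapDomain φ Q) = weight Q := by
  rw [weight, AddMonoidAlgebra.mapDomain, Finsupp.mapDomain_support_of_injective hφ, Finset.card_image_of_injective _ hφ, weight]

theorem poly_image (φ : Cell →+ Cell) (hφ : Function.Injective φ) (v : Cell) (F : Finset Cell) :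
    poly (F.image (fun c => φ c + v)) =
      single v 1 * AddMonoidAlgebra.mapDomainRingHom (ZMod 2) φ (poly F) := by
  rw [poly, Finset.sum_image (fun c _ d _ h => hφ (by simpa using h)), poly, map_sum,
    Finset.mul_sum]
  refine Finset.sum_congr rfl fun c _ => ?_
  simp [AddMonoidAlgebra.mapDomainRingHom, AddMonoidAlgebra.single_mul_single, add_comm]

/-- The numbers of ON cells do not change under an injective affine map, even if it is not
surjective: the powers of `poly F` are transported by the ring homomorphism it induces. -/
theorem combEquiv_image (φ : Cell →+ Cell) (hφ : Function.Injective φ) (v : Cell)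
    (F : Finset Cell) : CombEquiv (F.image (fun c => φ c + v)) F := by
  intro n
  rw [a_eq_weight, a_eq_weight, poly_image φ hφ, mul_pow, ← map_pow,
    AddMonoidAlgebra.single_pow, one_pow, weight_single_mul]
  exact weight_mapDomain φ hφ _

/-! ### Decimation -/

/-- The map `c ↦ 2 c + p` of the grid. -/
def dilate (p c : Cell) : Cell := (2 * c.1 + p.1, 2 * c.2 + p.2)

theorem dilate_injective (p : Cell) : Function.Injective (dilate p) := by
  rintro ⟨x, y⟩ ⟨z, w⟩ h
  simp only [dilate, Prod.mk.injEq] at h ⊢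
  omega

/-- The Laurent polynomial formed from the terms of `Q` with exponents in `p + 2 ℤ²`. -/
noncomputable def decimate (p : Cell) (Q : Laurent) : Laurent :=
  AddMonoidAlgebra.comapDomain (dilate p) (dilate_injective p) Q

theorem coeff_decimate (p : Cell) (Q : Laurent) (c : Cell) :
    (decimate p Q).coeff c = Q.coeff (dilate p c) := rfl

theorem decimate_add (p : Cell) (Q R : Laurent) :
    decimate p (Q + R) = decimate p Q + decimate p R :=
  AddMonoidAlgebra.comapDomain_add _ _ _ _

/-- Representatives of the four residue classes of the grid modulo `2`. -/
def residues : Finset Cell := {(0, 0), (1, 0), (0, 1), (1, 1)}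

theorem weight_eq_sum_decimate (Q : Laurent) :
    weight Q = ∑ p ∈ residues, weight (decimate p Q) := by
  have hmaps : ∀ c ∈ Q.coeff.support, ((c.1 % 2, c.2 % 2) : Cell) ∈ residues := by
    rintro ⟨x, y⟩ -
    rcases Int.emod_two_eq x with hx | hx <;> rcases Int.emod_two_eq y with hy | hy <;>
      simp [residues, hx, hy]
  rw [weight, Finset.card_eq_sum_card_fiberwise (f := fun c : Cell => (c.1 % 2, c.2 % 2)) hmaps]
  refine Finset.sum_congr rfl fun p hp => ?_
  rw [weight, ← Finset.card_image_of_injective (decimate p Q).coeff.support (dilate_injective p)]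
  congr 1
  ext ⟨x, y⟩
  simp only [Finset.mem_filter, Finset.mem_image, Finsupp.mem_support_iff, coeff_decimate]
  constructor
  · rintro ⟨h, rfl⟩
    refine ⟨(x / 2, y / 2), ?_, ?_⟩
    · convert h using 2
      simp only [dilate, Prod.mk.injEq]
      omega
    · simp only [dilate, Prod.mk.injEq]
      omega
  · rintro ⟨c, h, h'⟩
    rw [h'] at h
    refine ⟨h, ?_⟩
    simp only [residues, Finset.mem_insert, Finset.mem_singleton] at hp
    simp only [dilate, Prod.mk.injEq] at h'
    rcases hp with rfl | rfl | rfl | rfl <;> simp only [Prod.mk.injEq] <;> dsimp at h' <;> omega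

/-- The Frobenius map doubles all exponents. -/
theorem sq_eq_mapDomain (Q : Laurent) :
    Q ^ 2 = AddMonoidAlgebra.mapDomain (fun c : Cell => c + c) Q := by
  have h2 : (2 : Laurent) = 0 := by
    rw [← Nat.cast_ofNat, AddMonoidAlgebra.natCast_def]
    have : ((2 : ℕ) : ZMod 2) = 0 := rfl
    rw [this, AddMonoidAlgebra.single_zero]
  induction Q using AddMonoidAlgebra.induction_linear with
  | zero => simp
  | add x y hx hy =>
    rw [AddMonoidAlgebra.mapDomain_add, ← hx, ← hy, add_sq, h2]
    ring
  | single m r =>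
    rw [AddMonoidAlgebra.mapDomain_single, AddMonoidAlgebra.single_pow, two_nsmul]
    congr 1
    revert r
    decide

theorem decimate_mul_sq (p : Cell) (Q R : Laurent) :
    decimate p (Q * R ^ 2) = decimate p Q * R := by
  rw [sq_eq_mapDomain]
  induction R using AddMonoidAlgebra.induction_linear with
  | zero => simp [decimate]
  | add x y hx hy => rw [AddMonoidAlgebra.mapDomain_add, mul_add, mul_add, decimate_add, hx, hy]
  | single m r =>
    ext c
    rw [AddMonoidAlgebra.mapDomain_single, coeff_decimate,
      AddMonoidAlgebra.coeff_mul_single_apply, AddMonoidAlgebra.coeff_mul_single_apply,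
      coeff_decimate]
    congr 2
    simp only [dilate, Prod.ext_iff, Prod.fst_add, Prod.snd_add, Prod.fst_neg, Prod.snd_neg]
    omega

/-- The recursion behind everything: a square factor can be pulled out of the weight of a product
by decimating the other factor. -/
theorem weight_mul_sq (Q R : Laurent) :
    weight (Q * R ^ 2) = ∑ p ∈ residues, weight (decimate p Q * R) := by
  rw [weight_eq_sum_decimate]
  simp_rw [decimate_mul_sq]

/-! ### The sixteen states -/

/-- The position of a cell of the `2 × 2` block when the block is encoded by a binary number. -/
def blockDigit (d : Cell) : ℕ := (2 * d.2 + d.1).toNat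

/-- The subset of the block `{0, 1}²` with code `h < 16`. -/
def block (h : ℕ) : Finset Cell := residues.filter (fun d => h.testBit (blockDigit d))

/-- The indicator function of the neighborhood with Odd-rule number `N`, moved to the square
`{0, 1, 2}²` by a point reflection in the first coordinate, so that the digit of `(i, j)` is
`3 j + i`. -/
def gridBit (N : ℕ) (c : Cell) : Bool :=
  (decide (0 ≤ c.1) && decide (c.1 ≤ 2) && decide (0 ≤ c.2) && decide (c.2 ≤ 2)) &&
    N.testBit (3 * c.2 + c.1).toNat

/-- The subset of `{0, 1, 2}²` with indicator function `gridBit N`. -/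
def grid (N : ℕ) : Finset Cell :=
  (({0, 1, 2} : Finset ℤ) ×ˢ ({0, 1, 2} : Finset ℤ)).filter (fun c => gridBit N c)

theorem mem_grid (N : ℕ) (c : Cell) : c ∈ grid N ↔ gridBit N c := by
  obtain ⟨x, y⟩ := c
  simp only [grid, Finset.mem_filter, Finset.mem_product, Finset.mem_insert,
    Finset.mem_singleton, and_iff_right_iff_imp]
  intro h
  simp only [gridBit, Bool.and_eq_true, decide_eq_true_eq] at h
  omega

theorem nbhd_eq_image_grid (N : ℕ) :
    nbhd N = (grid N).image
      (fun c => (AddMonoidHom.prodMap (-AddMonoidHom.id ℤ) (AddMonoidHom.id ℤ)) c + (1, -1)) := by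
  ext ⟨x, y⟩
  rw [nbhd, Finset.mem_filter, Finset.mem_product, Finset.mem_image]
  simp only [Finset.mem_insert, Finset.mem_singleton, mem_grid, gridBit, Prod.exists, digit,
    Bool.and_eq_true, decide_eq_true_eq, AddMonoidHom.prodMap, AddMonoidHom.prod_apply,
    AddMonoidHom.comp_apply, AddMonoidHom.neg_apply, AddMonoidHom.id_apply, Prod.mk_add_mk,
    Prod.mk.injEq, AddMonoidHom.coe_fst, AddMonoidHom.coe_snd]
  constructor
  · rintro ⟨h, h'⟩
    refine ⟨1 - x, y + 1, ⟨by omega, h'⟩, by omega, by omega⟩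
  · rintro ⟨i, j, ⟨h, h'⟩, rfl, rfl⟩
    refine ⟨by omega, ?_⟩
    convert h' using 3
    ring

theorem combEquiv_grid (N : ℕ) : CombEquiv (nbhd N) (grid N) := by
  rw [nbhd_eq_image_grid]
  refine combEquiv_image _ ?_ _ _
  exact Prod.map_injective.mpr ⟨neg_injective, Function.injective_id⟩

/-- The coefficient at `e` of the product of `poly (block h)` and `poly (grid N)`. -/
def prodBit (N h : ℕ) (e : Cell) : Bool :=
  ((h.testBit 0 && gridBit N (e.1, e.2)) ^^ (h.testBit 1 && gridBit N (e.1 - 1, e.2))) ^^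
    ((h.testBit 2 && gridBit N (e.1, e.2 - 1)) ^^ (h.testBit 3 && gridBit N (e.1 - 1, e.2 - 1)))

/-- The state that is reached from the state `h` by multiplying with `poly (grid N)` and taking
the terms in the residue class `p`. -/
def next (N h : ℕ) (p : Cell) : ℕ :=
  (prodBit N h p).toNat + 2 * (prodBit N h (2 + p.1, p.2)).toNat +
    4 * (prodBit N h (p.1, 2 + p.2)).toNat + 8 * (prodBit N h (2 + p.1, 2 + p.2)).toNat

theorem coeff_block_mul_grid (N h : ℕ) (e : Cell) :
    (poly (block h) * poly (grid N)).coeff e = if prodBit N h e then 1 else 0 := by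
  have key : ∀ b₀ b₁ b₂ b₃ c₀ c₁ c₂ c₃ : Bool,
      ((if b₀ then (if c₀ then 1 else 0) else 0) + ((if b₁ then (if c₁ then 1 else 0) else 0) +
        ((if b₂ then (if c₂ then 1 else 0) else 0) + (if b₃ then (if c₃ then 1 else 0) else 0)))
        : ZMod 2) =
      if ((b₀ && c₀) ^^ (b₁ && c₁)) ^^ ((b₂ && c₂) ^^ (b₃ && c₃)) then 1 else 0 := by
    decide
  obtain ⟨x, y⟩ := e
  rw [coeff_mul_poly, Finset.card_filter, Nat.cast_sum, block, Finset.sum_filter]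
  rw [prodBit, ← key, residues, Finset.sum_insert (by decide), Finset.sum_insert (by decide),
    Finset.sum_insert (by decide), Finset.sum_singleton]
  simp [mem_grid, blockDigit]

theorem testBit_ofBits (b₀ b₁ b₂ b₃ : Bool) :
    (b₀.toNat + 2 * b₁.toNat + 4 * b₂.toNat + 8 * b₃.toNat).testBit 0 = b₀ ∧
    (b₀.toNat + 2 * b₁.toNat + 4 * b₂.toNat + 8 * b₃.toNat).testBit 1 = b₁ ∧
    (b₀.toNat + 2 * b₁.toNat + 4 * b₂.toNat + 8 * b₃.toNat).testBit 2 = b₂ ∧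
    (b₀.toNat + 2 * b₁.toNat + 4 * b₂.toNat + 8 * b₃.toNat).testBit 3 = b₃ := by
  revert b₀ b₁ b₂ b₃
  decide

theorem decimate_block_mul_grid (N h : ℕ) {p : Cell} (hp : p ∈ residues) :
    decimate p (poly (block h) * poly (grid N)) = poly (block (next N h p)) := by
  ext c
  rw [coeff_decimate, coeff_block_mul_grid, coeff_poly]
  refine if_congr ?_ rfl rfl
  rw [block, Finset.mem_filter]
  obtain ⟨h₀, h₁, h₂, h₃⟩ := testBit_ofBits (prodBit N h p) (prodBit N h (2 + p.1, p.2))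
    (prodBit N h (p.1, 2 + p.2)) (prodBit N h (2 + p.1, 2 + p.2))
  by_cases hc : c ∈ residues
  · rw [and_iff_right hc, next]
    obtain ⟨x, y⟩ := p
    simp only [residues, Finset.mem_insert, Finset.mem_singleton] at hc
    rcases hc with rfl | rfl | rfl | rfl <;> simp [blockDigit, dilate, h₀, h₁, h₂, h₃]
  · simp only [hc, false_and, iff_false]
    -- the product has degree at most 3 in each variable
    obtain ⟨x, y⟩ := c
    have hx : x < 0 ∨ 1 < x ∨ y < 0 ∨ 1 < y := by
      by_contra! hcon
      apply hc
      simp only [residues, Finset.mem_insert, Finset.mem_singleton, Prod.mk.injEq]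
      omega
    have hg : ∀ i j : ℤ, 0 ≤ i → i ≤ 1 → 0 ≤ j → j ≤ 1 →
        gridBit N (2 * x + p.1 - i, 2 * y + p.2 - j) = false := by
      intro i j _ _ _ _
      rw [Bool.eq_false_iff]
      intro hb
      simp only [gridBit, Bool.and_eq_true, decide_eq_true_eq] at hb
      simp only [residues, Finset.mem_insert, Finset.mem_singleton] at hp
      rcases hp with rfl | rfl | rfl | rfl <;> dsimp at hb <;> omega
    have h00 := hg 0 0 (by norm_num) (by norm_num) (by norm_num) (by norm_num)
    have h10 := hg 1 0 (by norm_num) (by norm_num) (by norm_num) (by norm_num)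
    have h01 := hg 0 1 (by norm_num) (by norm_num) (by norm_num) (by norm_num)
    have h11 := hg 1 1 (by norm_num) (by norm_num) (by norm_num) (by norm_num)
    simp only [sub_zero] at h00 h10 h01
    simp [prodBit, dilate, h00, h10, h01, h11]

/-- The number of terms of the product of a block and the `n`-th power of a grid. -/
noncomputable def blockWeight (N n h : ℕ) : ℕ := weight (poly (block h) * poly (grid N) ^ n)

theorem poly_block_one : poly (block 1) = 1 := by
  have : block 1 = {(0, 0)} := by decide
  rw [this, poly, Finset.sum_singleton, AddMonoidAlgebra.one_def, Prod.mk_zero_zero]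

theorem a_nbhd (N n : ℕ) : a (nbhd N) n = blockWeight N n 1 := by
  rw [combEquiv_grid N n, a_eq_weight, blockWeight, poly_block_one, one_mul]

theorem blockWeight_zero (N h : ℕ) : blockWeight N 0 h = (block h).card := by
  rw [blockWeight, pow_zero, mul_one, weight_poly]

theorem blockWeight_odd (N n h : ℕ) :
    blockWeight N (2 * n + 1) h = ∑ p ∈ residues, blockWeight N n (next N h p) := by
  rw [blockWeight, pow_succ', ← mul_assoc, mul_comm 2 n, pow_mul, weight_mul_sq]
  exact Finset.sum_congr rfl fun p hp => by rw [decimate_block_mul_grid N h hp, blockWeight]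

theorem blockWeight_even (N n h : ℕ) :
    blockWeight N (2 * n) h = (block h).card * blockWeight N n 1 := by
  have hw : ∀ p ∈ residues, weight (decimate p (poly (block h)) * poly (grid N) ^ n) =
      if h.testBit (blockDigit p) then blockWeight N n 1 else 0 := by
    intro p hp
    have : decimate p (poly (block h)) = if h.testBit (blockDigit p) then 1 else 0 := by
      ext c
      have hmem : dilate p c ∈ block h ↔ c = 0 ∧ h.testBit (blockDigit p) := by
        obtain ⟨x, y⟩ := c
        rw [block, Finset.mem_filter, Prod.mk_eq_zero]
        constructor
        · rintro ⟨hd, hb⟩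
          have h0 : x = 0 ∧ y = 0 := by
            simp only [residues, Finset.mem_insert, Finset.mem_singleton, dilate,
              Prod.mk.injEq] at hp hd
            rcases hp with rfl | rfl | rfl | rfl <;> dsimp at hd <;> omega
          obtain ⟨rfl, rfl⟩ := h0
          exact ⟨⟨rfl, rfl⟩, by simpa [dilate] using hb⟩
        · rintro ⟨⟨rfl, rfl⟩, hb⟩
          simpa [dilate] using ⟨hp, hb⟩
      rw [coeff_decimate, coeff_poly, if_congr hmem rfl rfl]
      split_ifs <;> simp_all [AddMonoidAlgebra.one_def]
    rw [this]
    split_ifs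
    · rw [blockWeight, poly_block_one]
    · simp [weight]
  rw [blockWeight, mul_comm 2 n, pow_mul, weight_mul_sq, Finset.sum_congr rfl hw,
    ← Finset.sum_filter, Finset.sum_const, smul_eq_mul, block]

/-! ### Linear recurrences and rational generating functions -/

/-- By the Cayley–Hamilton theorem, the orbits of a square matrix of size `d` satisfy a common
linear recurrence of order `d`. -/
theorem exists_recurrence {d : ℕ} (M : Matrix (Fin d) (Fin d) ℤ) (v : ℕ → Fin d → ℤ)
    (hv : ∀ n, v (n + 1) = M.mulVec (v n)) :
    ∃ c : ℕ → ℤ, ∀ n i, v (n + d) i = ∑ j ∈ range d, c j * v (n + j) i := by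
  have hpow : ∀ n k, v (n + k) = (M ^ k).mulVec (v n) := by
    intro n k
    induction k with
    | zero => simp
    | succ k ih => rw [← add_assoc, hv, ih, Matrix.mulVec_mulVec, pow_succ']
  refine ⟨fun j => -M.charpoly.coeff j, fun n i => ?_⟩
  have hdeg : M.charpoly.natDegree = d := by
    rw [Matrix.charpoly_natDegree_eq_dim, Fintype.card_fin]
  have hlead : M.charpoly.coeff d = 1 := by
    have := M.charpoly_monic.coeff_natDegree
    rwa [hdeg] at this
  have h0 := M.aeval_self_charpoly
  rw [Polynomial.aeval_eq_sum_range, hdeg, Finset.sum_range_succ, hlead, one_smul] at h0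
  have h1 := congrFun (congrArg (fun A : Matrix (Fin d) (Fin d) ℤ => A.mulVec (v n)) h0) i
  simp only [Matrix.add_mulVec, Matrix.sum_mulVec, Matrix.smul_mulVec, Matrix.zero_mulVec,
    Pi.add_apply, Finset.sum_apply, Pi.smul_apply, Pi.zero_apply, smul_eq_mul, ← hpow] at h1
  simp only [neg_mul, Finset.sum_neg_distrib]
  linarith

/-- A sequence that satisfies a linear recurrence of order `d` from some index on vanishes from
there on if it has `d` consecutive zeros there. -/
theorem eq_zero_of_recurrence {d : ℕ} {c : ℕ → ℤ} {s : ℕ → ℤ}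
    (hs : ∀ n, s (n + d) = ∑ j ∈ range d, c j * s (n + j)) (h0 : ∀ n < d, s n = 0) (n : ℕ) :
    s n = 0 := by
  induction n using Nat.strong_induction_on with
  | _ n ih =>
    by_cases hn : n < d
    · exact h0 n hn
    · obtain ⟨m, rfl⟩ := Nat.exists_eq_add_of_le' (not_lt.mp hn)
      rw [hs]
      refine Finset.sum_eq_zero fun j hj => ?_
      rw [ih (m + j) (by have := Finset.mem_range.mp hj; omega), mul_zero]

theorem coeff_ofCoeffs (l : List ℤ) (n : ℕ) : (ofCoeffs l).coeff n = l.getD n 0 := by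
  induction l generalizing n with
  | nil => simp [ofCoeffs]
  | cons c l ih =>
    cases n with
    | zero => simp [ofCoeffs]
    | succ n => rw [ofCoeffs, Polynomial.coeff_add, Polynomial.coeff_X_mul, Polynomial.coeff_C_succ, ih,
        zero_add, List.getD_cons_succ]

/-- Sum of two polynomials given by their coefficients. -/
def addCoeffs : List ℤ → List ℤ → List ℤ
  | [], l => l
  | l, [] => l
  | c :: l, c' :: l' => (c + c') :: addCoeffs l l'

/-- Product of two polynomials given by their coefficients. -/
def mulCoeffs : List ℤ → List ℤ → List ℤ
  | [], _ => []
  | c :: l, l' => addCoeffs (l'.map (c * ·)) (0 :: mulCoeffs l l')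

theorem ofCoeffs_addCoeffs (l l' : List ℤ) :
    ofCoeffs (addCoeffs l l') = ofCoeffs l + ofCoeffs l' := by
  induction l generalizing l' with
  | nil => simp [addCoeffs, ofCoeffs]
  | cons c l ih =>
    cases l' with
    | nil => simp [addCoeffs, ofCoeffs]
    | cons c' l' =>
      simp only [addCoeffs, ofCoeffs, ih, Polynomial.C_add]
      ring

theorem ofCoeffs_mulCoeffs (l l' : List ℤ) :
    ofCoeffs (mulCoeffs l l') = ofCoeffs l * ofCoeffs l' := by
  have hmap : ∀ (c : ℤ) (l : List ℤ), ofCoeffs (l.map (c * ·)) = Polynomial.C c * ofCoeffs l := by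
    intro c l
    induction l with
    | nil => simp [ofCoeffs]
    | cons c' l ih =>
      simp only [List.map_cons, ofCoeffs, ih, Polynomial.C_mul]
      ring
  induction l with
  | nil => simp [mulCoeffs, ofCoeffs]
  | cons c l ih =>
    simp only [mulCoeffs, ofCoeffs, ofCoeffs_addCoeffs, hmap, ih, Polynomial.C_0]
    ring

/-- The coefficients of a product of polynomials given by their coefficients. -/
def prodCoeffs (l : List (List ℤ)) : List ℤ := l.foldr mulCoeffs [1]

theorem ofFactors_eq (l : List (List ℤ)) : ofFactors l = ofCoeffs (prodCoeffs l) := by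
  induction l with
  | nil => simp [ofFactors, prodCoeffs, ofCoeffs]
  | cons c l ih =>
    rw [ofFactors, List.map_cons, List.prod_cons, ← ofFactors, ih, ← ofCoeffs_mulCoeffs]
    rfl

/-- A candidate for the generating function of a sequence that satisfies a linear recurrence of
order `d` is correct if it is correct up to an order that exceeds the lengths of numerator and
denominator by `d`. -/
theorem hasGenFun_of_check {d L : ℕ} {c : ℕ → ℤ} {u : ℕ → ℕ} {num den : List ℤ}
    (hu : ∀ n, (u (n + d) : ℤ) = ∑ j ∈ range d, c j * u (n + j))
    (hnum : num.length ≤ L) (hden : den.length ≤ L) (h1 : den.getD 0 0 = 1)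
    (hcheck : ∀ n < L + d,
      ∑ k ∈ range (n + 1), den.getD k 0 * (u (n - k) : ℤ) = num.getD n 0) :
    HasGenFun u (ofCoeffs num) (ofCoeffs den) := by
  refine ⟨by rw [coeff_ofCoeffs, h1], ?_⟩
  have hzero : ∀ n, ∑ k ∈ range L, den.getD k 0 * (u (L + n - k) : ℤ) = 0 := by
    refine eq_zero_of_recurrence (d := d) (c := c) (fun n => ?_) (fun n hn => ?_)
    · simp_rw [Finset.mul_sum]
      rw [Finset.sum_comm]
      refine Finset.sum_congr rfl fun k hk => ?_
      have hk := Finset.mem_range.mp hk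
      rw [show L + (n + d) - k = (L + n - k) + d by omega, hu, Finset.mul_sum]
      refine Finset.sum_congr rfl fun j _ => ?_
      rw [show L + (n + j) - k = (L + n - k) + j by omega]
      ring
    · have h := hcheck (L + n) (by omega)
      rw [List.getD_eq_default _ _ (by omega : num.length ≤ L + n)] at h
      refine Eq.trans (Finset.sum_subset (fun k hk => ?_) (fun k _ hk => ?_)) h
      · have := Finset.mem_range.mp hk
        exact Finset.mem_range.mpr (by omega)
      · have : L ≤ k := by simpa using hk
        rw [List.getD_eq_default _ _ (by omega : den.length ≤ k), zero_mul]
  ext n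
  rw [PowerSeries.coeff_mul, Polynomial.coeff_coe, coeff_ofCoeffs,
    Finset.Nat.sum_antidiagonal_eq_sum_range_succ_mk]
  simp only [Polynomial.coeff_coe, coeff_ofCoeffs, PowerSeries.coeff_mk]
  by_cases hn : n < L + d
  · exact hcheck n hn
  · obtain ⟨m, rfl⟩ := Nat.exists_eq_add_of_le (by omega : L ≤ n)
    rw [List.getD_eq_default _ _ (by omega : num.length ≤ L + m)]
    refine Eq.trans (Finset.sum_subset (fun k hk => ?_) (fun k _ hk => ?_)).symm (hzero m)
    · have := Finset.mem_range.mp hk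
      exact Finset.mem_range.mpr (by omega)
    · have : L ≤ k := by simpa using hk
      rw [List.getD_eq_default _ _ (by omega : den.length ≤ k), zero_mul]

/-! ### The sequences `b_n` -/

theorem next_lt (N h : ℕ) (p : Cell) : next N h p < 16 := by
  have h₀ := Bool.toNat_le (prodBit N h p)
  have h₁ := Bool.toNat_le (prodBit N h (2 + p.1, p.2))
  have h₂ := Bool.toNat_le (prodBit N h (p.1, 2 + p.2))
  have h₃ := Bool.toNat_le (prodBit N h (2 + p.1, 2 + p.2))
  rw [next]
  omega

theorem blockWeight_two_pow_succ (N n h : ℕ) :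
    blockWeight N (2 ^ (n + 1) - 1) h =
      ∑ p ∈ residues, blockWeight N (2 ^ n - 1) (next N h p) := by
  rw [← blockWeight_odd]
  congr 1
  have := Nat.one_le_two_pow (n := n)
  rw [pow_succ]
  omega

theorem b_nbhd (N n : ℕ) : b (nbhd N) n = blockWeight N (2 ^ n - 1) 1 := a_nbhd N _

/-- The matrix of the recursion for the weights at the generations `2 ^ n - 1`. -/
def transferMatrix (N : ℕ) : Matrix (Fin 16) (Fin 16) ℤ :=
  fun h k => ∑ p ∈ residues, if next N h p = k then 1 else 0

theorem b_recurrence (N : ℕ) :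
    ∃ c : ℕ → ℤ, ∀ n, (b (nbhd N) (n + 16) : ℤ) = ∑ j ∈ range 16, c j * b (nbhd N) (n + j) := by
  obtain ⟨c, hc⟩ := exists_recurrence (transferMatrix N)
    (fun n h => (blockWeight N (2 ^ n - 1) h : ℤ)) (fun n => by
      ext h
      rw [blockWeight_two_pow_succ, Nat.cast_sum, Matrix.mulVec, dotProduct]
      simp only [transferMatrix, Finset.sum_mul]
      rw [Finset.sum_comm]
      refine Finset.sum_congr rfl fun p _ => ?_
      rw [Finset.sum_eq_single (⟨next N h p, next_lt N h p⟩ : Fin 16)]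
      · simp
      · intro k _ hk
        rw [if_neg (fun h' => hk (Fin.ext h'.symm)), zero_mul]
      · simp)
  refine ⟨c, fun n => ?_⟩
  simp only [b_nbhd]
  exact hc n 1

/-- The successors of the sixteen states. -/
def successors (N : ℕ) : List (List ℕ) :=
  (List.range 16).map fun h => [next N h (0, 0), next N h (1, 0), next N h (0, 1), next N h (1, 1)]

/-- One step of the recursion for the weights, with the sixteen weights in a list. -/
def evolve (t : List (List ℕ)) (w : List ℕ) : List ℕ :=
  t.map fun l => (l.map fun k => w.getD k 0).sum

/-- The entries with index `1` of the first `k` iterates of `evolve t`. -/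
def entries (t : List (List ℕ)) : ℕ → List ℕ → List ℕ
  | 0, _ => []
  | k + 1, w => w.getD 1 0 :: entries t k (evolve t w)

/-- The first `k` terms of the sequence `b_n` for the neighborhood with number `N`. -/
def initialTerms (N k : ℕ) : List ℕ :=
  entries (successors N) k ((List.range 16).map fun h => (block h).card)

theorem initialTerms_eq (N k : ℕ) : initialTerms N k = (List.range k).map (b (nbhd N)) := by
  have hstep : ∀ n, evolve (successors N)
      ((List.range 16).map fun h => blockWeight N (2 ^ n - 1) h) =
      (List.range 16).map fun h => blockWeight N (2 ^ (n + 1) - 1) h := by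
    intro n
    rw [evolve, successors, List.map_map]
    refine List.map_congr_left fun h _ => ?_
    rw [blockWeight_two_pow_succ, residues, Finset.sum_insert (by decide),
      Finset.sum_insert (by decide), Finset.sum_insert (by decide), Finset.sum_singleton]
    have hget : ∀ p, ((List.range 16).map fun h => blockWeight N (2 ^ n - 1) h).getD (next N h p) 0
        = blockWeight N (2 ^ n - 1) (next N h p) := by
      intro p
      rw [List.getD_eq_getElem _ _ (by simpa using next_lt N h p)]
      simp
    simp only [Function.comp_apply, List.map_cons, List.map_nil, List.sum_cons, List.sum_nil, hget,
      add_zero]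
  have hgen : ∀ n, entries (successors N) k
      ((List.range 16).map fun h => blockWeight N (2 ^ n - 1) h) =
      (List.range k).map fun i => b (nbhd N) (n + i) := by
    induction k with
    | zero => intro n; rfl
    | succ k ih =>
      intro n
      rw [entries, hstep, ih, List.range_succ_eq_map (n := k), List.map_cons, List.map_map,
        add_zero, b_nbhd]
      congr 1
      refine List.map_congr_left fun i _ => ?_
      rw [Function.comp_apply, Nat.succ_eq_add_one]
      congr 1
      ring
  have h := hgen 0
  simp only [pow_zero, Nat.sub_self, blockWeight_zero, zero_add] at h
  exact h

/-- The coefficients up to order `n` of the power series with coefficients `l`, multiplied by the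
polynomial `den`. -/
def convolution (den : List ℤ) (l : List ℕ) (n : ℕ) : ℤ :=
  ∑ k ∈ range (n + 1), den.getD k 0 * ((l.getD (n - k) 0 : ℕ) : ℤ)

/-- The test of a generating function up to the order that decides about its correctness: with at
most `12` coefficients in numerator and denominator and a recurrence of order `16` for `b_n`, the
first `12 + 16 = 28` terms suffice. -/
def checkGenFun (N : ℕ) (num den : List ℤ) : Bool :=
  let l := initialTerms N 28
  decide (num.length ≤ 12) && decide (den.length ≤ 12) && decide (den.getD 0 0 = 1) &&
    (List.range 28).all fun n => decide (convolution den l n = num.getD n 0)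

theorem hasGenFun_of_checkGenFun {N : ℕ} {num den : List ℤ} (h : checkGenFun N num den) :
    HasGenFun (b (nbhd N)) (ofCoeffs num) (ofCoeffs den) := by
  simp only [checkGenFun, Bool.and_eq_true, decide_eq_true_eq, List.all_eq_true,
    List.mem_range] at h
  obtain ⟨⟨⟨hnum, hden⟩, h1⟩, hcheck⟩ := h
  obtain ⟨c, hc⟩ := b_recurrence N
  refine hasGenFun_of_check hc hnum hden h1 fun n hn => ?_
  rw [← hcheck n hn, convolution, initialTerms_eq]
  refine Finset.sum_congr rfl fun k _ => ?_
  have hlt : n - k < 28 := by omega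
  rw [List.getD_eq_getElem (List.map _ _) _ (by simpa using hlt), List.getElem_map,
    List.getElem_range]

theorem checkGenFun_genFunTable : ∀ e ∈ genFunTable,
    checkGenFun e.rule (prodCoeffs e.numFactors) (prodCoeffs e.denFactors) := by
  decide +kernel

theorem hasGenFun_genFunTable (e : Entry) (he : e ∈ genFunTable) :
    HasGenFun (b (nbhd e.rule)) e.num e.den := by
  rw [Entry.num, Entry.den, ofFactors_eq, ofFactors_eq]
  exact hasGenFun_of_checkGenFun (checkGenFun_genFunTable e he)

/-! ### Odd-rule numbers as codes of height-one neighborhoods -/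

theorem mem_nbhd (N : ℕ) (c : Cell) :
    c ∈ nbhd N ↔ (c.1.natAbs ≤ 1 ∧ c.2.natAbs ≤ 1) ∧ N.testBit (digit c) := by
  obtain ⟨x, y⟩ := c
  rw [nbhd, Finset.mem_filter, Finset.mem_product]
  simp only [Finset.mem_insert, Finset.mem_singleton]
  refine and_congr_left fun _ => ?_
  omega

theorem height_le_one_iff (F : Finset Cell) :
    height F ≤ 1 ↔ F ⊆ ({-1, 0, 1} : Finset ℤ) ×ˢ ({-1, 0, 1} : Finset ℤ) := by
  rw [height, Finset.sup_le_iff]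
  refine forall₂_congr fun c _ => ?_
  rw [Finset.mem_product]
  simp only [Finset.mem_insert, Finset.mem_singleton]
  omega

theorem height_nbhd (N : ℕ) : height (nbhd N) ≤ 1 :=
  (height_le_one_iff _).mpr (Finset.filter_subset _ _)

theorem ruleNumber_nbhd : ∀ N < 512, ruleNumber (nbhd N) = N := by
  decide +kernel

theorem nbhd_injOn : Set.InjOn nbhd {N | N < 512} := fun N hN N' hN' h => by
  rw [← ruleNumber_nbhd N hN, h, ruleNumber_nbhd N' hN']

/-- A count of the subsets of the `3 × 3` grid shows that each of them is some `nbhd N`. -/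
theorem exists_nbhd_eq {F : Finset Cell} (hF : height F ≤ 1) : ∃ N < 512, nbhd N = F := by
  obtain ⟨N, hN, h⟩ := Finset.surj_on_of_inj_on_of_card_le
    (s := range 512) (t := (({-1, 0, 1} : Finset ℤ) ×ˢ ({-1, 0, 1} : Finset ℤ)).powerset)
    (fun N _ => nbhd N) (fun N _ => Finset.mem_powerset.mpr (Finset.filter_subset _ _))
    (fun N N' hN hN' h => nbhd_injOn (Finset.mem_range.mp hN) (Finset.mem_range.mp hN') h)
    (by rw [Finset.card_powerset, Finset.card_range]; decide) F
    (Finset.mem_powerset.mpr ((height_le_one_iff F).mp hF))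
  exact ⟨N, Finset.mem_range.mp hN, h.symm⟩

/-! ### Trivial equivalence -/

/-- The quarter turn. -/
def rot (c : Cell) : Cell := (-c.2, c.1)

/-- The reflection in the vertical axis. -/
def refl (c : Cell) : Cell := (-c.1, c.2)

/-- The translate of a neighborhood. -/
def shift (v : Cell) (F : Finset Cell) : Finset Cell := F.image (fun c => c + v)

/-- The effect of the quarter turn on Odd-rule numbers: the binary digits at the positions
`0, …, 8` are moved to the positions `6, 3, 0, 7, 4, 1, 8, 5, 2`. -/
def rotNumber (N : ℕ) : ℕ :=
  (N &&& 1) <<< 6 ||| (N &&& 66) <<< 2 ||| (N &&& 8) <<< 4 ||| (N &&& 16) |||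
    (N &&& 132) >>> 2 ||| (N &&& 32) >>> 4 ||| (N &&& 256) >>> 6

/-- The effect of the reflection on Odd-rule numbers: the left and the right column are swapped. -/
def reflNumber (N : ℕ) : ℕ := (N &&& 73) <<< 2 ||| (N &&& 146) ||| (N &&& 292) >>> 2

/-- The Odd-rule number after a shift downwards by one row, if the bottom row is empty. -/
def dropRow (N : ℕ) : ℕ := if N % 8 = 0 then N / 8 else N

/-- The Odd-rule number after a shift to the right by one column, if the right column (with the
binary digits `0`, `3` and `6`) is empty. -/
def dropColumn (N : ℕ) : ℕ := if N &&& 73 = 0 then N / 2 else N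

/-- The Odd-rule number of the translate that touches the lower and the right side of the grid. -/
def corner (N : ℕ) : ℕ := dropColumn (dropColumn (dropRow (dropRow N)))

/-- The Odd-rule numbers of the images under the eight symmetries of the square. -/
def symmetryOrbit (N : ℕ) : List ℕ :=
  let l := [N, rotNumber N, rotNumber (rotNumber N), rotNumber (rotNumber (rotNumber N))]
  l ++ l.map reflNumber

/-- The smallest Odd-rule number in the trivial equivalence class. -/
def canonical (N : ℕ) : ℕ := ((symmetryOrbit N).map corner).foldr min (corner N)

theorem nbhd_rotNumber : ∀ N < 512, nbhd (rotNumber N) = (nbhd N).image rot := by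
  decide +kernel

theorem nbhd_reflNumber : ∀ N < 512, nbhd (reflNumber N) = (nbhd N).image refl := by
  decide +kernel

theorem numbers_lt : ∀ N < 512, rotNumber N < 512 ∧ reflNumber N < 512 ∧ corner N < 512 := by
  decide +kernel

theorem canonical_invariant : ∀ N < 512, canonical (rotNumber N) = canonical N ∧
    canonical (reflNumber N) = canonical N ∧ canonical (corner N) = canonical N := by
  decide +kernel

theorem canonical_le : ∀ N < 512, canonical N ≤ N := by
  decide +kernel

/-- The corner representative of a nonempty neighborhood has cells in the bottom row and in the right
column. -/
theorem corner_touches : ∀ N < 512, N ≠ 0 →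
    (∃ c ∈ nbhd (corner N), c.2 = -1) ∧ (∃ c ∈ nbhd (corner N), c.1 = 1) := by
  decide +kernel

theorem shift_nbhd_of_row : ∀ N < 512, N % 8 = 0 → nbhd (N / 8) = shift (0, -1) (nbhd N) := by
  decide +kernel

theorem shift_nbhd_of_column :
    ∀ N < 512, N &&& 73 = 0 → nbhd (N / 2) = shift (1, 0) (nbhd N) := by
  decide +kernel

theorem shift_shift (v w : Cell) (F : Finset Cell) : shift w (shift v F) = shift (v + w) F := by
  rw [shift, shift, shift, Finset.image_image]
  congr 1
  funext c
  exact add_assoc _ _ _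

theorem shift_zero (F : Finset Cell) : shift 0 F = F := by
  simp [shift]

theorem shift_injective (v : Cell) : Function.Injective (shift v) :=
  Finset.image_injective (add_left_injective v)

theorem mem_shift {v c : Cell} {F : Finset Cell} : c ∈ shift v F ↔ c - v ∈ F := by
  simp [shift, sub_eq_add_neg]

theorem exists_shift_dropRow {N : ℕ} (hN : N < 512) :
    dropRow N < 512 ∧ ∃ v, nbhd (dropRow N) = shift v (nbhd N) := by
  rw [dropRow]
  split_ifs with h
  · exact ⟨by omega, _, shift_nbhd_of_row N hN h⟩
  · exact ⟨hN, 0, (shift_zero _).symm⟩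

theorem exists_shift_dropColumn {N : ℕ} (hN : N < 512) :
    dropColumn N < 512 ∧ ∃ v, nbhd (dropColumn N) = shift v (nbhd N) := by
  rw [dropColumn]
  split_ifs with h
  · exact ⟨by omega, _, shift_nbhd_of_column N hN h⟩
  · exact ⟨hN, 0, (shift_zero _).symm⟩

theorem exists_shift_corner {N : ℕ} (hN : N < 512) :
    ∃ v, nbhd (corner N) = shift v (nbhd N) := by
  obtain ⟨h₁, v₁, e₁⟩ := exists_shift_dropRow hN
  obtain ⟨h₂, v₂, e₂⟩ := exists_shift_dropRow h₁
  obtain ⟨h₃, v₃, e₃⟩ := exists_shift_dropColumn h₂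
  obtain ⟨-, v₄, e₄⟩ := exists_shift_dropColumn h₃
  exact ⟨_, by rw [corner, e₄, e₃, e₂, e₁, shift_shift, shift_shift, shift_shift]⟩

/-- Two neighborhoods that touch the lower and the right side of the grid are equal if they are
translates of each other. -/
theorem corner_eq_of_shift_eq {N N' : ℕ} (hN : N < 512) (hN' : N' < 512) {v v' : Cell}
    (h : shift v (nbhd N) = shift v' (nbhd N')) : corner N = corner N' := by
  have hzero : ∀ {M M' : ℕ} {w w' : Cell}, M' < 512 → shift w (nbhd M) = shift w' (nbhd M') →
      M = 0 → M' = 0 := by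
    rintro M M' w w' hM' h rfl
    refine nbhd_injOn hM' (by norm_num : (0 : ℕ) < 512) (shift_injective w' ?_)
    have h0 : nbhd 0 = ∅ := by decide
    rw [← h, h0]
    rfl
  by_cases h0 : N = 0
  · rw [h0, hzero hN' h h0]
  have h0' : N' ≠ 0 := fun h' => h0 (hzero hN h.symm h')
  obtain ⟨u, hu⟩ := exists_shift_corner hN
  obtain ⟨u', hu'⟩ := exists_shift_corner hN'
  have hc : shift (v - u) (nbhd (corner N)) = shift (v' - u') (nbhd (corner N')) := by
    rw [hu, hu', shift_shift, shift_shift, add_sub_cancel, add_sub_cancel, h]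
  -- the extreme coordinates of the two translates
  have hbound : ∀ {M M' : ℕ} {w w' : Cell}, shift w (nbhd M) = shift w' (nbhd M') →
      (∃ c ∈ nbhd M, c.2 = -1) → (∃ c ∈ nbhd M, c.1 = 1) → w'.2 ≤ w.2 ∧ w.1 ≤ w'.1 := by
    rintro M M' w w' h ⟨c, hcM, hc⟩ ⟨d, hdM, hd⟩
    have hc' : c + w ∈ shift w' (nbhd M') := by
      rw [← h, mem_shift, add_sub_cancel_right]
      exact hcM
    have hd' : d + w ∈ shift w' (nbhd M') := by
      rw [← h, mem_shift, add_sub_cancel_right]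
      exact hdM
    rw [mem_shift, mem_nbhd] at hc' hd'
    have h1 := hc'.1.2
    have h2 := hd'.1.1
    simp only [Prod.snd_sub, Prod.snd_add, Prod.fst_sub, Prod.fst_add] at h1 h2
    omega
  obtain ⟨ht, ht'⟩ := corner_touches N hN h0
  obtain ⟨hs, hs'⟩ := corner_touches N' hN' h0'
  have hw : v - u = v' - u' :=
    Prod.ext (le_antisymm (hbound hc ht ht').2 (hbound hc.symm hs hs').2)
      (le_antisymm (hbound hc.symm hs hs').1 (hbound hc ht ht').1)
  rw [hw] at hc
  exact nbhd_injOn (numbers_lt N hN).2.2 (numbers_lt N' hN').2.2 (shift_injective _ hc)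

/-- The canonical numbers of the height-one translates of a neighborhood; a set with at most one
element that is invariant under all moves. -/
def canonicalSet (F : Finset Cell) : Set ℕ :=
  {k | ∃ N < 512, ∃ v, F = shift v (nbhd N) ∧ canonical N = k}

theorem canonicalSet_nbhd {N : ℕ} (hN : N < 512) : canonicalSet (nbhd N) = {canonical N} := by
  ext k
  constructor
  · rintro ⟨M, hM, v, h, rfl⟩
    rw [← shift_zero (nbhd N)] at h
    have hcorner := corner_eq_of_shift_eq hN hM h
    rw [Set.mem_singleton_iff, ← (canonical_invariant M hM).2.2, ← hcorner,
      (canonical_invariant N hN).2.2]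
  · rintro rfl
    exact ⟨N, hN, 0, (shift_zero _).symm, rfl⟩

theorem canonicalSet_shift_subset (v : Cell) (F : Finset Cell) :
    canonicalSet F ⊆ canonicalSet (shift v F) := by
  rintro k ⟨N, hN, w, rfl, hk⟩
  exact ⟨N, hN, w + v, shift_shift _ _ _, hk⟩

theorem canonicalSet_rot_subset (F : Finset Cell) :
    canonicalSet F ⊆ canonicalSet (F.image rot) := by
  rintro k ⟨N, hN, w, rfl, hk⟩
  refine ⟨rotNumber N, (numbers_lt N hN).1, rot w, ?_, by rw [(canonical_invariant N hN).1, hk]⟩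
  rw [nbhd_rotNumber N hN, shift, shift, Finset.image_image, Finset.image_image]
  congr 1
  funext c
  simp only [Function.comp_apply, rot, Prod.fst_add, Prod.snd_add, Prod.mk_add_mk, neg_add]

theorem canonicalSet_refl_subset (F : Finset Cell) :
    canonicalSet F ⊆ canonicalSet (F.image refl) := by
  rintro k ⟨N, hN, w, rfl, hk⟩
  refine ⟨reflNumber N, (numbers_lt N hN).2.1, refl w, ?_,
    by rw [(canonical_invariant N hN).2.1, hk]⟩
  rw [nbhd_reflNumber N hN, shift, shift, Finset.image_image, Finset.image_image]
  congr 1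
  funext c
  simp only [Function.comp_apply, refl, Prod.fst_add, Prod.snd_add, Prod.mk_add_mk, neg_add]

/-- Each move has an inverse that is composed of moves, so the inclusions above are equalities. -/
theorem canonicalSet_eq_of_move {F G : Finset Cell} (h : Move F G) :
    canonicalSet F = canonicalSet G := by
  cases h with
  | translate v F =>
    refine (canonicalSet_shift_subset v F).antisymm ?_
    have := canonicalSet_shift_subset (-v) (shift v F)
    rwa [shift_shift, add_neg_cancel, shift_zero] at this
  | rotate F =>
    refine (canonicalSet_rot_subset F).antisymm ?_
    have h := ((canonicalSet_rot_subset (F.image rot)).trans (canonicalSet_rot_subset _)).trans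
      (canonicalSet_rot_subset _)
    have hid : ((rot ∘ rot) ∘ rot) ∘ rot = id := by
      funext c
      simp [rot]
    rwa [Finset.image_image, Finset.image_image, Finset.image_image, hid, Finset.image_id] at h
  | reflect F =>
    refine (canonicalSet_refl_subset F).antisymm ?_
    have h := canonicalSet_refl_subset (F.image refl)
    have hid : refl ∘ refl = id := by
      funext c
      simp [refl]
    rwa [Finset.image_image, hid, Finset.image_id] at h

theorem canonicalSet_eq_of_trivEquiv {F G : Finset Cell} (h : TrivEquiv F G) :
    canonicalSet F = canonicalSet G := by
  induction h with
  | rel _ _ h => exact canonicalSet_eq_of_move h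
  | refl _ => rfl
  | symm _ _ _ ih => exact ih.symm
  | trans _ _ _ _ _ ih₁ ih₂ => exact ih₁.trans ih₂

theorem TrivEquiv.refl (F : Finset Cell) : TrivEquiv F F := Relation.EqvGen.refl F

theorem TrivEquiv.symm {F G : Finset Cell} (h : TrivEquiv F G) : TrivEquiv G F :=
  Relation.EqvGen.symm _ _ h

theorem TrivEquiv.trans {F G H : Finset Cell} (h : TrivEquiv F G) (h' : TrivEquiv G H) :
    TrivEquiv F H := Relation.EqvGen.trans _ _ _ h h'

theorem trivEquiv_rotNumber {N M : ℕ} (hM : M < 512) (h : TrivEquiv (nbhd N) (nbhd M)) :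
    TrivEquiv (nbhd N) (nbhd (rotNumber M)) := by
  rw [nbhd_rotNumber M hM]
  exact h.trans (Relation.EqvGen.rel _ _ (Move.rotate _))

theorem trivEquiv_reflNumber {N M : ℕ} (hM : M < 512) (h : TrivEquiv (nbhd N) (nbhd M)) :
    TrivEquiv (nbhd N) (nbhd (reflNumber M)) := by
  rw [nbhd_reflNumber M hM]
  exact h.trans (Relation.EqvGen.rel _ _ (Move.reflect _))

theorem trivEquiv_corner {N M : ℕ} (hM : M < 512) (h : TrivEquiv (nbhd N) (nbhd M)) :
    TrivEquiv (nbhd N) (nbhd (corner M)) := by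
  obtain ⟨v, hv⟩ := exists_shift_corner hM
  rw [hv]
  exact h.trans (Relation.EqvGen.rel _ _ (Move.translate v _))

theorem trivEquiv_of_mem_symmetryOrbit {N M : ℕ} (hN : N < 512) (hM : M ∈ symmetryOrbit N) :
    M < 512 ∧ TrivEquiv (nbhd N) (nbhd M) := by
  have hrot : ∀ {M}, (M < 512 ∧ TrivEquiv (nbhd N) (nbhd M)) →
      rotNumber M < 512 ∧ TrivEquiv (nbhd N) (nbhd (rotNumber M)) := fun h =>
    ⟨(numbers_lt _ h.1).1, trivEquiv_rotNumber h.1 h.2⟩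
  have hrefl : ∀ {M}, (M < 512 ∧ TrivEquiv (nbhd N) (nbhd M)) →
      reflNumber M < 512 ∧ TrivEquiv (nbhd N) (nbhd (reflNumber M)) := fun h =>
    ⟨(numbers_lt _ h.1).2.1, trivEquiv_reflNumber h.1 h.2⟩
  have h₀ : N < 512 ∧ TrivEquiv (nbhd N) (nbhd N) := ⟨hN, TrivEquiv.refl _⟩
  simp only [symmetryOrbit, List.map_cons, List.map_nil, List.cons_append, List.nil_append,
    List.mem_cons, List.not_mem_nil, or_false] at hM
  rcases hM with rfl | rfl | rfl | rfl | rfl | rfl | rfl | rfl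
  · exact h₀
  · exact hrot h₀
  · exact hrot (hrot h₀)
  · exact hrot (hrot (hrot h₀))
  · exact hrefl h₀
  · exact hrefl (hrot h₀)
  · exact hrefl (hrot (hrot h₀))
  · exact hrefl (hrot (hrot (hrot h₀)))

theorem trivEquiv_canonical {N : ℕ} (hN : N < 512) :
    TrivEquiv (nbhd N) (nbhd (canonical N)) := by
  have key : ∀ l : List ℕ, (∀ M ∈ l, M < 512 ∧ TrivEquiv (nbhd N) (nbhd M)) →
      TrivEquiv (nbhd N) (nbhd ((l.map corner).foldr min (corner N))) := by
    intro l hl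
    induction l with
    | nil => exact trivEquiv_corner hN (TrivEquiv.refl _)
    | cons M l ih =>
      rw [List.map_cons, List.foldr_cons]
      rcases min_choice (corner M) ((l.map corner).foldr min (corner N)) with h | h <;> rw [h]
      · exact trivEquiv_corner (hl M List.mem_cons_self).1 (hl M List.mem_cons_self).2
      · exact ih fun M hM => hl M (List.mem_cons_of_mem _ hM)
  exact key _ fun M hM => trivEquiv_of_mem_symmetryOrbit hN hM

/-- Trivial equivalence of height-one neighborhoods is decided by the canonical numbers. -/
theorem trivEquiv_nbhd_iff {N M : ℕ} (hN : N < 512) (hM : M < 512) :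
    TrivEquiv (nbhd N) (nbhd M) ↔ canonical N = canonical M := by
  constructor
  · intro h
    have := canonicalSet_eq_of_trivEquiv h
    rwa [canonicalSet_nbhd hN, canonicalSet_nbhd hM, Set.singleton_eq_singleton_iff] at this
  · intro h
    exact (trivEquiv_canonical hN).trans (h ▸ (trivEquiv_canonical hM).symm)

/-! ### Combinatorial equivalence -/

theorem CombEquiv.symm {F G : Finset Cell} (h : CombEquiv F G) : CombEquiv G F :=
  fun n => (h n).symm

theorem CombEquiv.trans {F G H : Finset Cell} (h : CombEquiv F G) (h' : CombEquiv G H) :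
    CombEquiv F H := fun n => (h n).trans (h' n)

/-- The linear map of the grid with matrix `!![p, q; r, s]`. -/
def linearMap (p q r s : ℤ) : Cell →+ Cell :=
  AddMonoidHom.mk' (fun c => (p * c.1 + q * c.2, r * c.1 + s * c.2)) fun c d => by
    simp only [Prod.fst_add, Prod.snd_add, Prod.mk_add_mk, Prod.mk.injEq]
    constructor <;> ring

theorem linearMap_injective {p q r s : ℤ} (h : p * s - q * r ≠ 0) :
    Function.Injective (linearMap p q r s) := by
  rw [injective_iff_map_eq_zero]
  rintro ⟨x, y⟩ hxy
  have h1 : p * x + q * y = 0 := congrArg Prod.fst hxy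
  have h2 : r * x + s * y = 0 := congrArg Prod.snd hxy
  have hx : (p * s - q * r) * x = 0 := by linear_combination s * h1 - q * h2
  have hy : (p * s - q * r) * y = 0 := by linear_combination p * h2 - r * h1
  rw [Prod.mk_eq_zero]
  exact ⟨(mul_eq_zero.mp hx).resolve_left h, (mul_eq_zero.mp hy).resolve_left h⟩

theorem combEquiv_of_move {F G : Finset Cell} (h : Move F G) : CombEquiv F G := by
  cases h with
  | translate v F => exact (combEquiv_image (AddMonoidHom.id Cell) Function.injective_id v F).symm
  | rotate F =>
    convert (combEquiv_image (linearMap 0 (-1) 1 0) (linearMap_injective (by decide)) 0 F).symm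
      using 2
    funext c
    simp [linearMap]
  | reflect F =>
    convert (combEquiv_image (linearMap (-1) 0 0 1) (linearMap_injective (by decide)) 0 F).symm
      using 2
    funext c
    simp [linearMap]

theorem combEquiv_of_trivEquiv {F G : Finset Cell} (h : TrivEquiv F G) : CombEquiv F G := by
  induction h with
  | rel _ _ h => exact combEquiv_of_move h
  | refl _ => exact fun _ => rfl
  | symm _ _ _ ih => exact ih.symm
  | trans _ _ _ _ _ ih₁ ih₂ => exact ih₁.trans ih₂

/-- The affine map `c ↦ A c + v` with `A = !![p, q; r, s]`, recorded as a witness that it carries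
the neighborhood with number `source` to the one with number `target`. -/
structure AffineWitness where
  target : ℕ
  source : ℕ
  p : ℤ
  q : ℤ
  r : ℤ
  s : ℤ
  v : Cell

/-- Affine maps, not necessarily surjective, between neighborhoods that are not trivially
equivalent. -/
def affineTable : List AffineWitness :=
  [
   ⟨octal 0 0 5, octal 0 0 3, 2, 1, 0, 1, (0, 0)⟩, ⟨octal 0 1 2, octal 0 0 3, 1, 0, 1, 1, (0, 0)⟩,
   ⟨octal 0 1 4, octal 0 0 3, -2, -1, -1, 0, (0, 0)⟩, ⟨octal 1 0 4, octal 0 0 3, 2, 0, 2, 1, (-1, 0)⟩,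
   ⟨octal 0 1 5, octal 0 1 3, 2, 0, 0, 1, (-1, 0)⟩, ⟨octal 0 1 6, octal 0 1 3, 1, 1, 0, 1, (0, 0)⟩,
   ⟨octal 0 2 5, octal 0 1 3, 1, 1, 1, -1, (0, -2)⟩, ⟨octal 1 0 5, octal 0 1 3, 2, 0, 0, 2, (-1, 1)⟩,
   ⟨octal 1 0 6, octal 0 1 3, 1, 1, 0, 2, (0, 1)⟩, ⟨octal 1 2 4, octal 0 0 7, 1, 0, 1, 1, (0, 1)⟩,
   ⟨octal 1 4 1, octal 0 1 3, 2, 0, -1, 2, (-1, 2)⟩, ⟨octal 1 4 2, octal 0 1 3, -1, 2, 1, 1, (2, 0)⟩,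
   ⟨octal 0 2 7, octal 0 1 7, -1, 1, 0, 1, (1, 0)⟩, ⟨octal 0 3 6, octal 0 3 3, 1, 1, 0, 1, (0, 0)⟩,
   ⟨octal 0 5 5, octal 0 3 3, 2, 0, 0, 1, (-1, 0)⟩, ⟨octal 1 0 7, octal 0 1 7, 1, 0, 0, 2, (0, 1)⟩,
   ⟨octal 1 1 6, octal 0 3 5, 1, 0, 1, -1, (0, -1)⟩, ⟨octal 1 2 5, octal 0 1 7, -1, 2, -1, 0, (2, 0)⟩,
   ⟨octal 1 2 6, octal 0 1 7, -1, 1, -1, 0, (1, 0)⟩, ⟨octal 1 4 5, octal 0 3 5, 0, -2, -1, 0, (-1, 0)⟩,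
   ⟨octal 1 5 1, octal 0 1 7, 0, -2, -1, 1, (-1, 1)⟩, ⟨octal 1 5 2, octal 1 4 6, -1, 0, -1, 1, (0, 0)⟩,
   ⟨octal 1 5 4, octal 0 3 3, 0, 2, 1, 1, (1, 0)⟩, ⟨octal 2 5 2, octal 0 3 3, -1, 1, 1, 1, (1, 0)⟩,
   ⟨octal 5 0 5, octal 0 3 3, 0, 2, 2, 0, (1, -1)⟩, ⟨octal 1 2 7, octal 1 1 7, -1, 1, 0, 1, (1, 0)⟩,
   ⟨octal 1 3 6, octal 0 3 7, 1, 0, 1, -1, (0, -1)⟩, ⟨octal 1 5 5, octal 0 3 7, 0, -2, -1, 0, (-1, 0)⟩,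
   ⟨octal 1 7 2, octal 1 6 6, -1, 0, -1, 1, (0, 0)⟩, ⟨octal 1 7 4, octal 2 7 2, 1, 1, 0, 1, (0, 0)⟩,
   ⟨octal 2 5 3, octal 1 5 6, 1, -1, 0, 1, (0, 0)⟩, ⟨octal 5 0 7, octal 0 5 7, 1, 0, 0, 2, (0, 1)⟩,
   ⟨octal 5 2 5, octal 2 7 2, -1, 1, 1, 1, (0, 0)⟩, ⟨octal 2 7 3, octal 1 7 6, 1, -1, 0, 1, (0, 0)⟩,
   ⟨octal 5 5 5, octal 0 7 7, 0, 2, 1, 0, (1, 0)⟩]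

theorem affineTable_spec : ∀ w ∈ affineTable, w.p * w.s - w.q * w.r ≠ 0 ∧
    nbhd w.target = (nbhd w.source).image
      (fun c => (w.p * c.1 + w.q * c.2, w.r * c.1 + w.s * c.2) + w.v) := by
  decide +kernel

theorem combEquiv_of_affineTable {N M : ℕ}
    (h : ∃ w ∈ affineTable, w.target = N ∧ w.source = M) : CombEquiv (nbhd N) (nbhd M) := by
  obtain ⟨w, hw, rfl, rfl⟩ := h
  obtain ⟨hdet, h⟩ := affineTable_spec w hw
  rw [h]
  exact combEquiv_image (linearMap w.p w.q w.r w.s) (linearMap_injective hdet) w.v _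

theorem blockWeight_odd_eq (N n h k₀ k₁ k₂ k₃ : ℕ)
    (hk : [next N h (0, 0), next N h (1, 0), next N h (0, 1), next N h (1, 1)] =
      [k₀, k₁, k₂, k₃]) :
    blockWeight N (2 * n + 1) h = blockWeight N n k₀ + (blockWeight N n k₁ +
      (blockWeight N n k₂ + blockWeight N n k₃)) := by
  simp only [List.cons.injEq, and_true] at hk
  obtain ⟨rfl, rfl, rfl, rfl⟩ := hk
  rw [blockWeight_odd, residues, Finset.sum_insert (by decide),
    Finset.sum_insert (by decide), Finset.sum_insert (by decide), Finset.sum_singleton]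

theorem blockWeight_block_zero (N n : ℕ) : blockWeight N n 0 = 0 := by
  have h0 : block 0 = ∅ := by decide
  simp [blockWeight, h0, poly, weight]

theorem card_block : (block 1).card = 1 ∧ (block 2).card = 1 ∧ (block 3).card = 2 ∧
    (block 4).card = 1 ∧ (block 5).card = 2 ∧ (block 6).card = 2 ∧ (block 8).card = 1 ∧
    (block 10).card = 2 ∧ (block 12).card = 2 ∧ (block 13).card = 3 ∧ (block 14).card = 3 ∧
    (block 15).card = 4 := by
  decide

/-- The four cells of either neighborhood lie in different residue classes modulo `2`, so that in both
cases an odd step leads from a single cell to four single cells. -/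
theorem combEquiv_162_033 : CombEquiv (nbhd (octal 1 6 2)) (nbhd (octal 0 3 3)) := by
  have key : ∀ n, blockWeight (octal 1 6 2) n 1 = blockWeight (octal 0 3 3) n 1 ∧
      blockWeight (octal 1 6 2) n 2 = blockWeight (octal 0 3 3) n 1 ∧
      blockWeight (octal 1 6 2) n 4 = blockWeight (octal 0 3 3) n 1 ∧
      blockWeight (octal 1 6 2) n 8 = blockWeight (octal 0 3 3) n 1 := by
    intro n
    induction n using Nat.evenOddRec with
    | h0 => simp [blockWeight_zero, card_block]
    | h_even n ih =>
      simp only [blockWeight_even, card_block, ih.1, and_self]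
    | h_odd n ih =>
      have := blockWeight_odd_eq (octal 1 6 2) n 1 4 1 2 1 (by decide)
      have := blockWeight_odd_eq (octal 1 6 2) n 2 2 4 2 2 (by decide)
      have := blockWeight_odd_eq (octal 1 6 2) n 4 8 4 4 1 (by decide)
      have := blockWeight_odd_eq (octal 1 6 2) n 8 8 8 2 4 (by decide)
      have := blockWeight_odd_eq (octal 0 3 3) n 1 1 1 1 1 (by decide)
      omega
  intro n
  rw [a_nbhd, a_nbhd]
  exact (key n).1

/-- In both cases all single cells have the same weights, and so have all pairs of cells that occur;
an odd step leads from a single cell to two pairs and a single cell, and from a pair to two single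
cells and two pairs. -/
theorem combEquiv_272_057 : CombEquiv (nbhd (octal 2 7 2)) (nbhd (octal 0 5 7)) := by
  have key : ∀ n, blockWeight (octal 2 7 2) n 1 = blockWeight (octal 0 5 7) n 1 ∧
      blockWeight (octal 2 7 2) n 2 = blockWeight (octal 0 5 7) n 1 ∧
      blockWeight (octal 2 7 2) n 4 = blockWeight (octal 0 5 7) n 1 ∧
      blockWeight (octal 2 7 2) n 8 = blockWeight (octal 0 5 7) n 1 ∧
      blockWeight (octal 0 5 7) n 2 = blockWeight (octal 0 5 7) n 1 ∧
      blockWeight (octal 2 7 2) n 3 = blockWeight (octal 0 5 7) n 3 ∧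
      blockWeight (octal 2 7 2) n 5 = blockWeight (octal 0 5 7) n 3 ∧
      blockWeight (octal 2 7 2) n 10 = blockWeight (octal 0 5 7) n 3 ∧
      blockWeight (octal 2 7 2) n 12 = blockWeight (octal 0 5 7) n 3 := by
    intro n
    induction n using Nat.evenOddRec with
    | h0 => simp [blockWeight_zero, card_block]
    | h_even n ih =>
      simp only [blockWeight_even, card_block, ih.1, and_self]
    | h_odd n ih =>
      have := blockWeight_odd_eq (octal 2 7 2) n 1 0 5 3 1 (by decide)
      have := blockWeight_odd_eq (octal 2 7 2) n 2 10 0 2 3 (by decide)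
      have := blockWeight_odd_eq (octal 2 7 2) n 3 10 5 1 2 (by decide)
      have := blockWeight_odd_eq (octal 2 7 2) n 4 12 4 0 5 (by decide)
      have := blockWeight_odd_eq (octal 2 7 2) n 5 12 1 3 4 (by decide)
      have := blockWeight_odd_eq (octal 2 7 2) n 8 8 12 10 0 (by decide)
      have := blockWeight_odd_eq (octal 2 7 2) n 10 2 12 8 3 (by decide)
      have := blockWeight_odd_eq (octal 2 7 2) n 12 4 8 10 5 (by decide)
      have := blockWeight_odd_eq (octal 0 5 7) n 1 3 1 3 0 (by decide)
      have := blockWeight_odd_eq (octal 0 5 7) n 2 2 3 0 3 (by decide)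
      have := blockWeight_odd_eq (octal 0 5 7) n 3 1 2 3 3 (by decide)
      have := blockWeight_block_zero (octal 2 7 2) n
      have := blockWeight_block_zero (octal 0 5 7) n
      omega
  intro n
  rw [a_nbhd, a_nbhd]
  exact (key n).1

/-- Here the states do not correspond to each other, but the weights of the full block, of the
triples and of the pairs satisfy two linear relations that are preserved by even and odd steps. -/
theorem combEquiv_557_376 : CombEquiv (nbhd (octal 5 5 7)) (nbhd (octal 3 7 6)) := by
  have key : ∀ n, blockWeight (octal 5 5 7) n 1 = blockWeight (octal 3 7 6) n 1 ∧
      blockWeight (octal 5 5 7) n 2 = blockWeight (octal 3 7 6) n 1 ∧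
      blockWeight (octal 3 7 6) n 2 = blockWeight (octal 3 7 6) n 1 ∧
      blockWeight (octal 3 7 6) n 4 = blockWeight (octal 3 7 6) n 1 ∧
      blockWeight (octal 3 7 6) n 8 = blockWeight (octal 3 7 6) n 1 ∧
      blockWeight (octal 3 7 6) n 5 = blockWeight (octal 3 7 6) n 3 ∧
      blockWeight (octal 3 7 6) n 6 = blockWeight (octal 3 7 6) n 3 ∧
      blockWeight (octal 3 7 6) n 10 = blockWeight (octal 3 7 6) n 3 ∧
      blockWeight (octal 3 7 6) n 12 = blockWeight (octal 3 7 6) n 3 ∧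
      blockWeight (octal 5 5 7) n 14 = blockWeight (octal 5 5 7) n 13 ∧
      blockWeight (octal 5 5 7) n 15 + blockWeight (octal 5 5 7) n 3 = 3 * blockWeight (octal 3 7 6) n 3 ∧
      2 * blockWeight (octal 5 5 7) n 13 + blockWeight (octal 5 5 7) n 3 = 2 * blockWeight (octal 3 7 6) n 1 + 3 * blockWeight (octal 3 7 6) n 3 := by
    intro n
    induction n using Nat.evenOddRec with
    | h0 => simp [blockWeight_zero, card_block]
    | h_even n ih =>
      simp only [blockWeight_even, card_block, ih.1, true_and]
      omega
    | h_odd n ih =>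
      obtain ⟨e1, e2, e3, e4, e5, e6, e7, e8, e9, e10, e11, e12⟩ := ih
      simp only [
        blockWeight_odd_eq (octal 5 5 7) n 1 15 1 3 0 (by decide),
        blockWeight_odd_eq (octal 5 5 7) n 2 2 15 0 3 (by decide),
        blockWeight_odd_eq (octal 5 5 7) n 3 13 14 3 3 (by decide),
        blockWeight_odd_eq (octal 5 5 7) n 13 3 13 14 14 (by decide),
        blockWeight_odd_eq (octal 5 5 7) n 14 14 3 13 13 (by decide),
        blockWeight_odd_eq (octal 5 5 7) n 15 1 2 14 13 (by decide),
        blockWeight_odd_eq (octal 3 7 6) n 1 6 5 3 1 (by decide),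
        blockWeight_odd_eq (octal 3 7 6) n 2 10 6 2 3 (by decide),
        blockWeight_odd_eq (octal 3 7 6) n 3 12 3 1 2 (by decide),
        blockWeight_odd_eq (octal 3 7 6) n 4 12 4 6 5 (by decide),
        blockWeight_odd_eq (octal 3 7 6) n 5 10 1 5 4 (by decide),
        blockWeight_odd_eq (octal 3 7 6) n 6 6 2 4 6 (by decide),
        blockWeight_odd_eq (octal 3 7 6) n 8 8 12 10 6 (by decide),
        blockWeight_odd_eq (octal 3 7 6) n 10 2 10 8 5 (by decide),
        blockWeight_odd_eq (octal 3 7 6) n 12 4 8 12 3 (by decide),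
        blockWeight_block_zero, e1, e2, e3, e4, e5, e6, e7, e8, e9, e10]
      omega
  intro n
  rw [a_nbhd, a_nbhd]
  exact (key n).1

theorem ruleTable_cases : ∀ t ∈ ruleTable, t.1 = t.2 ∨
    (∃ w ∈ affineTable, w.target = t.1 ∧ w.source = t.2) ∨
    t ∈ [(octal 1 6 2, octal 0 3 3), (octal 2 7 2, octal 0 5 7), (octal 1 7 4, octal 0 5 7),
      (octal 5 2 5, octal 0 5 7), (octal 5 5 7, octal 3 7 6)] := by
  decide +kernel

theorem combEquiv_of_mem_ruleTable {t : ℕ × ℕ} (ht : t ∈ ruleTable) :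
    CombEquiv (nbhd t.1) (nbhd t.2) := by
  rcases ruleTable_cases t ht with h | h | h
  · rw [h]
    exact fun _ => rfl
  · exact combEquiv_of_affineTable h
  · simp only [List.mem_cons, List.not_mem_nil, or_false] at h
    rcases h with rfl | rfl | rfl | rfl | rfl
    · exact combEquiv_162_033
    · exact combEquiv_272_057
    · exact (combEquiv_of_affineTable (by decide +kernel)).trans combEquiv_272_057
    · exact (combEquiv_of_affineTable (by decide +kernel)).trans combEquiv_272_057
    · exact combEquiv_557_376

/-! ### The classification -/

theorem initialTerms_nodup : (genFunTable.map fun e => initialTerms e.rule 5).Nodup := by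
  decide +kernel

theorem eq_of_b_eq {e e' : Entry} (he : e ∈ genFunTable) (he' : e' ∈ genFunTable)
    (h : b (nbhd e.rule) = b (nbhd e'.rule)) : e = e' :=
  List.inj_on_of_nodup_map initialTerms_nodup he he' (by rw [initialTerms_eq, initialTerms_eq, h])

theorem eq_of_combEquiv {e e' : Entry} (he : e ∈ genFunTable) (he' : e' ∈ genFunTable)
    (h : CombEquiv (nbhd e.rule) (nbhd e'.rule)) : e = e' :=
  eq_of_b_eq he he' (funext fun n => h (2 ^ n - 1))

/-- A sequence is determined by its generating function. -/
theorem eq_of_hasGenFun {u u' : ℕ → ℕ} {num den num' den' : Polynomial ℤ}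
    (h : HasGenFun u num den) (h' : HasGenFun u' num' den') (heq : num * den' = num' * den) :
    u = u' := by
  have hne : (den : PowerSeries ℤ) * (den' : PowerSeries ℤ) ≠ 0 := by
    refine mul_ne_zero ?_ ?_ <;> intro h0 <;> rw [Polynomial.coe_eq_zero_iff] at h0
    · simpa [h0] using h.1
    · simpa [h0] using h'.1
  have hcoe : (num : PowerSeries ℤ) * (den' : PowerSeries ℤ) =
      (num' : PowerSeries ℤ) * (den : PowerSeries ℤ) := by
    rw [← Polynomial.coe_mul, heq, Polynomial.coe_mul]
  have hmk : PowerSeries.mk (fun n => (u n : ℤ)) = PowerSeries.mk (fun n => (u' n : ℤ)) := by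
    apply mul_left_cancel₀ hne
    linear_combination (den' : PowerSeries ℤ) * h.2 - (den : PowerSeries ℤ) * h'.2 + hcoe
  funext n
  have := congrArg (PowerSeries.coeff n) hmk
  simpa using this

theorem canonical_mem_ruleTable : ∀ N < 512, ∃ t ∈ ruleTable, t.1 = canonical N := by
  decide +kernel

theorem ruleTable_canonical : ∀ t ∈ ruleTable, t.1 < 512 ∧ canonical t.1 = t.1 ∧ t.2 ≤ t.1 ∧
    ∃ e ∈ genFunTable, e.rule = t.2 := by
  decide +kernel

theorem genFunTable_rule_lt : ∀ e ∈ genFunTable, e.rule < 512 := by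
  decide +kernel

theorem ruleTable_nodup : (ruleTable.map Prod.fst).Nodup := by
  decide +kernel

theorem genFunTable_nodup : genFunTable.Nodup := List.Nodup.of_map _ initialTerms_nodup

theorem existsUnique_trivEquiv {F : Finset Cell} (hF : height F ≤ 1) :
    ∃! t : ℕ × ℕ, t ∈ ruleTable ∧ TrivEquiv F (nbhd t.1) := by
  obtain ⟨N, hN, rfl⟩ := exists_nbhd_eq hF
  obtain ⟨t, ht, h⟩ := canonical_mem_ruleTable N hN
  refine ⟨t, ⟨ht, by rw [h]; exact trivEquiv_canonical hN⟩, ?_⟩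
  rintro t' ⟨ht', h'⟩
  obtain ⟨hlt, hcan, -⟩ := ruleTable_canonical t' ht'
  rw [trivEquiv_nbhd_iff hN hlt, hcan] at h'
  exact List.inj_on_of_nodup_map ruleTable_nodup ht' ht (h'.symm.trans h.symm)

theorem le_ruleNumber_of_trivEquiv {t : ℕ × ℕ} (ht : t ∈ ruleTable) {F : Finset Cell}
    (hF : height F ≤ 1) (h : TrivEquiv F (nbhd t.1)) : t.1 ≤ ruleNumber F := by
  obtain ⟨N, hN, rfl⟩ := exists_nbhd_eq hF
  obtain ⟨hlt, hcan, -⟩ := ruleTable_canonical t ht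
  rw [trivEquiv_nbhd_iff hN hlt, hcan] at h
  rw [ruleNumber_nbhd N hN, ← h]
  exact canonical_le N hN

/-- Every height-one neighborhood is combinatorially equivalent to a listed one whose number is
not larger. -/
theorem exists_combEquiv {F : Finset Cell} (hF : height F ≤ 1) :
    ∃ e ∈ genFunTable, CombEquiv F (nbhd e.rule) ∧ e.rule ≤ ruleNumber F := by
  obtain ⟨t, ⟨ht, h⟩, -⟩ := existsUnique_trivEquiv hF
  obtain ⟨-, -, hle, e, he, hrule⟩ := ruleTable_canonical t ht
  refine ⟨e, he, ?_, ?_⟩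
  · rw [hrule]
    exact (combEquiv_of_trivEquiv h).trans (combEquiv_of_mem_ruleTable ht)
  · rw [hrule]
    exact hle.trans (le_ruleNumber_of_trivEquiv ht hF h)

/-- The number of classes of a setoid is the length of a list that indexes a system of
representatives. -/
theorem card_quotient_eq_length {α β : Type*} (r : Setoid α) (l : List β) (hl : l.Nodup)
    (f : β → α) (h : ∀ x, ∃! y, y ∈ l ∧ r x (f y)) : Nat.card (Quotient r) = l.length := by
  have hbij : Function.Bijective (fun y : {y // y ∈ l} => (Quotient.mk r (f y.1))) := by
    constructor
    · rintro ⟨y, hy⟩ ⟨y', hy'⟩ hyy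
      exact Subtype.ext ((h (f y)).unique ⟨hy, r.refl _⟩ ⟨hy', Quotient.exact hyy⟩)
    · intro q
      induction q using Quotient.inductionOn with
      | h x =>
        obtain ⟨y, ⟨hy, hxy⟩, -⟩ := h x
        exact ⟨⟨y, hy⟩, Quotient.sound (r.symm hxy)⟩
  classical
  rw [← Nat.card_congr (Equiv.ofBijective _ hbij), ← List.toFinset_card_of_nodup hl]
  simp only [← List.mem_toFinset (l := l)]
  exact Nat.subtype_card _ fun _ => Iff.rfl

end OddRule

theorem theorem4 :
    -- up to combinatorial equivalence there are exactly 48 height-one neighborhoods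
    Nat.card (Quotient OddRule.combSetoid) = 48 ∧
    -- the table of 48 rules is a system of representatives, each of them the smallest in its class
    OddRule.genFunTable.length = 48 ∧
    (∀ F : Finset OddRule.Cell, OddRule.height F ≤ 1 →
      ∃! e : OddRule.Entry, e ∈ OddRule.genFunTable ∧
        OddRule.CombEquiv F (OddRule.nbhd e.rule)) ∧
    (∀ e ∈ OddRule.genFunTable, OddRule.height (OddRule.nbhd e.rule) ≤ 1 ∧
      OddRule.ruleNumber (OddRule.nbhd e.rule) = e.rule ∧
      ∀ F : Finset OddRule.Cell, OddRule.height F ≤ 1 →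
        OddRule.CombEquiv F (OddRule.nbhd e.rule) → e.rule ≤ OddRule.ruleNumber F) ∧
    -- the 48 generating functions of the sequences `b_n` are the listed ones, and are distinct
    (∀ e ∈ OddRule.genFunTable,
      OddRule.HasGenFun (OddRule.b (OddRule.nbhd e.rule)) e.num e.den) ∧
    (∀ e ∈ OddRule.genFunTable, ∀ e' ∈ OddRule.genFunTable,
      e.num * e'.den = e'.num * e.den → e = e') ∧
    -- up to trivial equivalence there are exactly 86 height-one neighborhoods, the listed ones
    Nat.card (Quotient OddRule.trivSetoid) = 86 ∧
    OddRule.ruleTable.length = 86 ∧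
    (∀ F : Finset OddRule.Cell, OddRule.height F ≤ 1 →
      ∃! t : ℕ × ℕ, t ∈ OddRule.ruleTable ∧ OddRule.TrivEquiv F (OddRule.nbhd t.1)) ∧
    (∀ t ∈ OddRule.ruleTable, OddRule.height (OddRule.nbhd t.1) ≤ 1 ∧
      OddRule.ruleNumber (OddRule.nbhd t.1) = t.1 ∧
      ∀ F : Finset OddRule.Cell, OddRule.height F ≤ 1 →
        OddRule.TrivEquiv F (OddRule.nbhd t.1) → t.1 ≤ OddRule.ruleNumber F) ∧
    -- each of the 86 is combinatorially equivalent to the listed one of the 48 representatives,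
    -- and its sequence `b_n` has the generating function of that representative
    (∀ t ∈ OddRule.ruleTable, ∃ e ∈ OddRule.genFunTable, e.rule = t.2 ∧
      OddRule.CombEquiv (OddRule.nbhd t.1) (OddRule.nbhd t.2) ∧
      OddRule.HasGenFun (OddRule.b (OddRule.nbhd t.1)) e.num e.den) := by
  have hcomb : ∀ F : Finset OddRule.Cell, OddRule.height F ≤ 1 →
      ∃! e : OddRule.Entry, e ∈ OddRule.genFunTable ∧
        OddRule.CombEquiv F (OddRule.nbhd e.rule) := by
    intro F hF
    obtain ⟨e, he, h, -⟩ := OddRule.exists_combEquiv hF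
    exact ⟨e, ⟨he, h⟩, fun e' h' => OddRule.eq_of_combEquiv h'.1 he (h'.2.symm.trans h)⟩
  have hrule : ∀ e ∈ OddRule.genFunTable,
      OddRule.ruleNumber (OddRule.nbhd e.rule) = e.rule := fun e he =>
    OddRule.ruleNumber_nbhd _ (OddRule.genFunTable_rule_lt e he)
  refine ⟨?_, rfl, hcomb, fun e he => ⟨OddRule.height_nbhd _, hrule e he, fun F hF h => ?_⟩,
    OddRule.hasGenFun_genFunTable, fun e he e' he' h => ?_, ?_, rfl,
    fun F hF => OddRule.existsUnique_trivEquiv hF,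
    fun t ht => ⟨OddRule.height_nbhd _,
      OddRule.ruleNumber_nbhd _ (OddRule.ruleTable_canonical t ht).1,
      fun F hF h => OddRule.le_ruleNumber_of_trivEquiv ht hF h⟩, fun t ht => ?_⟩
  · exact OddRule.card_quotient_eq_length OddRule.combSetoid OddRule.genFunTable
      OddRule.genFunTable_nodup (fun e => ⟨OddRule.nbhd e.rule, OddRule.height_nbhd _⟩)
      fun F => hcomb F.1 F.2
  · obtain ⟨e', he', h', hle⟩ := OddRule.exists_combEquiv hF
    rwa [OddRule.eq_of_combEquiv he he' (h.symm.trans h')]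
  · exact OddRule.eq_of_b_eq he he' (OddRule.eq_of_hasGenFun
      (OddRule.hasGenFun_genFunTable e he) (OddRule.hasGenFun_genFunTable e' he') h)
  · exact OddRule.card_quotient_eq_length OddRule.trivSetoid OddRule.ruleTable
      (List.Nodup.of_map _ OddRule.ruleTable_nodup)
      (fun t => ⟨OddRule.nbhd t.1, OddRule.height_nbhd _⟩)
      fun F => OddRule.existsUnique_trivEquiv F.2
  · obtain ⟨-, -, -, e, he, hrule⟩ := OddRule.ruleTable_canonical t ht
    have h := OddRule.combEquiv_of_mem_ruleTable ht
    refine ⟨e, he, hrule, h, ?_⟩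
    have hb : OddRule.b (OddRule.nbhd t.1) = OddRule.b (OddRule.nbhd e.rule) := by
      rw [hrule]
      exact funext fun n => h (2 ^ n - 1)
    rw [hb]
    exact OddRule.hasGenFun_genFunTable e he
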